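/- Let $\ell\ge 2$, and let $\mathrm{Sp}_{2\ell}=\mathrm{Sp}_{2\ell}(\mathbb C)$ be the group of the matrices that preserve the alternating form with Gram matrix $K\cdot\mathrm{Diag}(1,\dots,1,-1,\dots,-1)$, where $K$ is the $2\ell\times 2\ell$ matrix with ones on the antidiagonal and there are $\ell$ entries $1$ and $\ell$ entries $-1$. Let $A$ be its subgroup of diagonal matrices, $N(A)$ the normalizer of $A$ in $\mathrm{Sp}_{2\ell}$, and $W=N(A)/A$ the Weyl group of type $C_\ell$. For $1\le k<\ell$ let $s_k\in N(A)$ be the permutation matrix that exchanges the basis vectors $k,k+1$ and also $2\ell-k,2\ell-k+1$; let $t_\ell\in N(A)$ be the identity except for the block $\begin{pmatrix}0&1\\-1&0\end{pmatrix}$ in rows and columns $\ell,\ell+1$; and put $t_k=s_ks_{k+1}\cdots s_{\ell-1}\,t_\ell\,s_{\ell-1}\cdots s_{k+1}s_k$ for $1\le k<\ell$. For a partition $\vec\ell=(\ell_\mu\ge\cdots\ge\ell_1)$ of $\ell$ into positive parts put $\ell'_\nu=\ell_1+\cdots+\ell_{\nu-1}$ and $$n_{\vec\ell}=\prod_{\nu=1}^{\mu}\bigl(s_{\ell'_\nu+1}s_{\ell'_\nu+2}\cdots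 s_{\ell'_\nu+\ell_\nu-1}\,t_{\ell'_\nu+\ell_\nu}\bigr),$$ the factors being taken in the order $\nu=1,\dots,\mu$. The conjugacy class in $W$ of the image of $n_{\vec\ell}$ is the elliptic class attached to $\vec\ell$. Let $G$ be a group of type $C_\ell$, given by a surjective homomorphism $\pi:\mathrm{Sp}_{2\ell}\to G$ with central kernel, with maximal torus $\pi(A)$. Identify $X_*(\pi(A))\otimes\mathbb R$ with $V=\mathbb R^\ell$, with simple roots $\alpha_k=e_k-e_{k+1}$ for $1\le k<\ell$ and $\alpha_\ell=2e_\ell$, highest root $\tilde\alpha=2\alpha_1+\cdots+2\alpha_{\ell-1}+\alpha_\ell=2e_1$, fundamental coweights $\check\omega_k=e_1+\cdots+e_k$ for $1\le k<\ell$ and $\check\omega_\ell=\frac12(e_1+\cdots+e_\ell)$, and closed fundamental alcove $\overline C=\{x\in V:\alpha_k(x)\ge0\text{ for all }k,\ \tilde\alpha(x)\le1\}$. Put $b_0=b_\ell=1$ and $b_k=2$ for $1\le k<\ell$. Let $g\in G$ have finite order $M$, and let $\xi$ be a primitive $M$-th root of unity. A Kac diagram of $g$ with respect to $\xi$ is a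 labeling of the nodes $\gamma_0,\gamma_1,\dots,\gamma_\ell$ of the affine Dynkin diagram of type $C_\ell$ that is obtained as follows. Take a cocharacter $\lambda$ of $\pi(A)$ such that $g$ is $G$-conjugate to $\lambda(\xi)$ and $\lambda/M\in\overline C$, and integers $s_0,\dots,s_\ell\ge0$ with $\lambda/M=\frac1M\sum_{k=1}^{\ell}s_k\check\omega_k$ and $M=\sum_{k=0}^{\ell}b_ks_k$; then label $\gamma_k$ by $s_k$ divided by the greatest common divisor of $s_0,\dots,s_\ell$. **Statement.** Let $\vec\ell$ be a partition of $\ell$, let $m=4\,\mathrm{lcm}(\ell_1,\dots,\ell_\mu)$, and let $\sigma_1\ge\sigma_2\ge\cdots\ge\sigma_\ell$ be the numbers $(2a-1)m/(4\ell_\nu)$ with $1\le\nu\le\mu$ and $1\le a\le\ell_\nu$, listed with multiplicity in decreasing order. Let $n\in N(A)$ be any element whose image in $W$ lies in the elliptic class attached to $\vec\ell$ (for example $n=n_{\vec\ell}$). Then $n$ has order $m$, the element $\pi(n)$ has finite order, and for every primitive root of unity $\xi$ whose order is that of $\pi(n)$, the element $\pi(n)$ has exactly one Kac diagram with respect to $\xi$.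 It is obtained from the labels $$m-2\sigma_1\ \text{at }\gamma_0,\qquad \sigma_k-\sigma_{k+1}\ \text{at }\gamma_k\ (1\le k\le\ell-1),\qquad 2\sigma_\ell\ \text{at }\gamma_\ell$$ by dividing all of them by their greatest common divisor. -/

import Mathlib

open scoped Matrix

noncomputable section

namespace KacC

/-! ### The symplectic group and its diagonal torus -/

/-- `Sp_{2ℓ}(ℂ)`.  The standard basis `1, …, ℓ, ℓ+1, …, 2ℓ` of `ℂ^{2ℓ}` is indexed by
`Fin ℓ ⊕ Fin ℓ`: `inl k` is the basis index `k` and `inr k` is the basis index `2ℓ + 1 - k`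
(with `k` counted from `1`).  Under this indexing the form whose matrix is the antidiagonal matrix
times `Diag(1, …, 1, -1, …, -1)` is the matrix `Matrix.J`. -/
abbrev Sp (ℓ : ℕ) : Type := ↥(Matrix.symplecticGroup (Fin ℓ) ℂ)

/-- The subgroup `A` of diagonal matrices in `Sp_{2ℓ}(ℂ)`. -/
def torus (ℓ : ℕ) : Subgroup (Sp ℓ) where
  carrier := {g | (g : Matrix (Fin ℓ ⊕ Fin ℓ) (Fin ℓ ⊕ Fin ℓ) ℂ).IsDiag}
  one_mem' := Matrix.isDiag_one
  mul_mem' := by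
    intro a b ha hb
    simp only [Set.mem_ofPred_eq, Submonoid.coe_mul] at *
    rw [← ha.diagonal_diag, ← hb.diagonal_diag, Matrix.diagonal_mul_diagonal]
    exact Matrix.isDiag_diagonal _
  inv_mem' := by
    intro a ha
    simp only [Set.mem_ofPred_eq, SymplecticGroup.coe_inv'] at *
    rw [← ha.diagonal_diag, Matrix.inv_diagonal]
    exact Matrix.isDiag_diagonal _

/-- The element `Diag(a₁, …, a_ℓ, a_ℓ⁻¹, …, a₁⁻¹)` of `A`. -/
def torusElt {ℓ : ℕ} (a : Fin ℓ → ℂˣ) : Sp ℓ :=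
  ⟨Matrix.fromBlocks (Matrix.diagonal fun k => (a k : ℂ)) 0
      0 (Matrix.diagonal fun k => ((a k)⁻¹ : ℂ)), by
    rw [SymplecticGroup.mem_iff]
    simp [Matrix.J, Matrix.fromBlocks_multiply, Matrix.fromBlocks_transpose,
      ← Matrix.diagonal_one, -Matrix.fromBlocks_diagonal]⟩

/-! ### Lifts of the simple reflections, and the elements `n` attached to partitions -/

/-- For a permutation `τ` of the first `ℓ` basis vectors, the element of `Sp_{2ℓ}` that permutes
both halves of the basis by `τ`. -/
def permElt {ℓ : ℕ} (τ : Equiv.Perm (Fin ℓ)) : Sp ℓ :=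
  ⟨Matrix.fromBlocks (τ.permMatrix ℂ) 0 0 (τ.permMatrix ℂ), by
    rw [SymplecticGroup.mem_iff]
    simp [Matrix.J, Matrix.fromBlocks_multiply, Matrix.fromBlocks_transpose,
      ← Matrix.permMatrix_mul]⟩

/-- The transposition of the (0-based) positions `k` and `k + 1`; the identity if `k + 1 ≥ ℓ`. -/
def adjSwap (ℓ k : ℕ) : Equiv.Perm (Fin ℓ) :=
  if h : k + 1 < ℓ then Equiv.swap ⟨k, by omega⟩ ⟨k + 1, h⟩ else 1

/-- The lift `s_{k+1}` of the simple reflection in `α_{k+1} = e_{k+1} - e_{k+2}`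
(`k` is 0-based). -/
def sElt (ℓ k : ℕ) : Sp ℓ := permElt (adjSwap ℓ k)

/-- The lift `t_ℓ` of the simple reflection in `α_ℓ = 2 e_ℓ`: it is the identity except on the two
middle basis vectors, where it is `!![0, 1; -1, 0]`. -/
def tLast (ℓ : ℕ) : Sp ℓ :=
  ⟨Matrix.fromBlocks
      (Matrix.diagonal fun k : Fin ℓ => if (k : ℕ) + 1 = ℓ then 0 else 1)
      (Matrix.diagonal fun k : Fin ℓ => if (k : ℕ) + 1 = ℓ then 1 else 0)
      (Matrix.diagonal fun k : Fin ℓ => if (k : ℕ) + 1 = ℓ then -1 else 0)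
      (Matrix.diagonal fun k : Fin ℓ => if (k : ℕ) + 1 = ℓ then 0 else 1), by
    rw [SymplecticGroup.mem_iff]
    simp only [Matrix.J, Matrix.fromBlocks_multiply, Matrix.fromBlocks_transpose,
      Matrix.diagonal_transpose, ← Matrix.diagonal_one, ← Matrix.diagonal_zero,
      Matrix.diagonal_mul_diagonal, Matrix.diagonal_add, Matrix.diagonal_neg]
    congr 2 <;> (ext k; split_ifs <;> simp)⟩

/-- The list `s_{a+1}, s_{a+2}, …, s_{a+r}`. -/
def sRun (ℓ a r : ℕ) : List (Sp ℓ) := (List.range' a r).map (sElt ℓ)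

/-- `t_{k+1} = s_{k+1} s_{k+2} ⋯ s_{ℓ-1} · t_ℓ · s_{ℓ-1} ⋯ s_{k+2} s_{k+1}` (`k` is 0-based). -/
def tElt (ℓ k : ℕ) : Sp ℓ :=
  (sRun ℓ k (ℓ - 1 - k)).prod * tLast ℓ * (sRun ℓ k (ℓ - 1 - k)).reverse.prod

/-- `c = s_{o+1} s_{o+2} ⋯ s_{o+r-1} · t_{o+r}`, the factor for a part `r ≥ 1` placed after
parts of total size `o`. -/
def cycleElt (ℓ o r : ℕ) : Sp ℓ := (sRun ℓ o (r - 1)).prod * tElt ℓ (o + r - 1)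

/-- The product of the factors `cycleElt` for a list of parts, the first one having offset `o`. -/
def partsElt (ℓ : ℕ) : ℕ → List ℕ → Sp ℓ
  | _, [] => 1
  | o, r :: rs => cycleElt ℓ o r * partsElt ℓ (o + r) rs

/-- The element `n` of `Sp_{2ℓ}` attached to a partition `ℓ₁ ≤ ℓ₂ ≤ ⋯ ≤ ℓ_μ` of `ℓ`; it is
`c₁ c₂ ⋯ c_μ` with `c_ν = cycleElt ℓ (ℓ₁ + ⋯ + ℓ_{ν-1}) ℓ_ν`. -/
def nElt {ℓ : ℕ} (p : ℓ.Partition) : Sp ℓ := partsElt ℓ 0 (p.parts.sort (· ≤ ·))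

/-- The normalizer `N(A)` of the diagonal torus in `Sp_{2ℓ}`. -/
abbrev normTorus (ℓ : ℕ) : Subgroup (Sp ℓ) := Subgroup.normalizer (torus ℓ : Set (Sp ℓ))

/-- The Weyl group `N(A)/A`. -/
abbrev Weyl (ℓ : ℕ) : Type := ↥(normTorus ℓ) ⧸ (torus ℓ).subgroupOf (normTorus ℓ)

theorem mem_torus_iff {ℓ : ℕ} (g : Sp ℓ) : g ∈ torus ℓ ↔ ∃ d e : Fin ℓ → ℂ,
    (g : Matrix (Fin ℓ ⊕ Fin ℓ) (Fin ℓ ⊕ Fin ℓ) ℂ) =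
      Matrix.fromBlocks (Matrix.diagonal d) 0 0 (Matrix.diagonal e) := by
  constructor
  · intro h
    refine ⟨fun k => g.1 (Sum.inl k) (Sum.inl k),
      fun k => g.1 (Sum.inr k) (Sum.inr k), ?_⟩
    rw [Matrix.fromBlocks_diagonal]
    conv_lhs => rw [← Matrix.IsDiag.diagonal_diag h]
    congr 1
    ext (k | k) <;> rfl
  · rintro ⟨d, e, h⟩
    change Matrix.IsDiag g.1
    rw [h, Matrix.fromBlocks_diagonal]
    exact Matrix.isDiag_diagonal _

theorem mem_normTorus_of_conj {ℓ : ℕ} (g : Sp ℓ) (h₁ : ∀ a ∈ torus ℓ, g * a * g⁻¹ ∈ torus ℓ)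
    (h₂ : ∀ a ∈ torus ℓ, g⁻¹ * a * g ∈ torus ℓ) : g ∈ normTorus ℓ := by
  rw [Subgroup.mem_normalizer_iff]
  refine fun a => ⟨h₁ a, fun h => ?_⟩
  simpa [mul_assoc] using h₂ _ h

theorem permElt_mem {ℓ : ℕ} (τ : Equiv.Perm (Fin ℓ)) : permElt τ ∈ normTorus ℓ := by
  have key : ∀ (τ : Equiv.Perm (Fin ℓ)), ∀ a ∈ torus ℓ,
      permElt τ * a * permElt τ⁻¹ ∈ torus ℓ := by
    intro τ a ha
    obtain ⟨d, e, h⟩ := (mem_torus_iff a).1 ha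
    have hP : ∀ f : Fin ℓ → ℂ, τ.permMatrix ℂ * Matrix.diagonal f * (τ⁻¹).permMatrix ℂ =
        Matrix.diagonal fun k => f (τ k) := by
      intro f
      ext i j
      simp only [Matrix.mul_apply, Equiv.Perm.permMatrix, PEquiv.toMatrix_apply,
        Matrix.diagonal_apply, Equiv.toPEquiv_apply, Option.mem_some_iff, ite_mul, mul_ite,
        one_mul, zero_mul, mul_one, mul_zero]
      rw [Finset.sum_eq_single (τ i)]
      · simp
      · intro k _ hk
        simp [Ne.symm hk]
      · simp
    refine (mem_torus_iff _).2 ⟨fun k => d (τ k), fun k => e (τ k), ?_⟩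
    simp [permElt, h, Matrix.fromBlocks_multiply, hP, -Matrix.fromBlocks_diagonal]
  have hinv : (permElt τ)⁻¹ = permElt τ⁻¹ := by
    rw [inv_eq_iff_mul_eq_one]
    ext1
    simp [permElt, Matrix.fromBlocks_multiply, ← Matrix.permMatrix_mul]
  refine mem_normTorus_of_conj _ (fun a ha => hinv ▸ key τ a ha) fun a ha => ?_
  simpa [hinv] using key τ⁻¹ a ha

theorem tLast_mem (ℓ : ℕ) : tLast ℓ ∈ normTorus ℓ := by
  refine mem_normTorus_of_conj _ (fun a ha => ?_) fun a ha => ?_ <;>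
  · obtain ⟨d, e, h⟩ := (mem_torus_iff a).1 ha
    refine (mem_torus_iff _).2 ⟨fun k => if (k : ℕ) + 1 = ℓ then e k else d k,
      fun k => if (k : ℕ) + 1 = ℓ then d k else e k, ?_⟩
    simp only [Submonoid.coe_mul, SymplecticGroup.coe_inv, h, tLast, Matrix.J,
      Matrix.fromBlocks_multiply, Matrix.fromBlocks_transpose, Matrix.fromBlocks_neg,
      Matrix.diagonal_transpose, ← Matrix.diagonal_one, ← Matrix.diagonal_zero,
      Matrix.diagonal_mul_diagonal, Matrix.diagonal_add, Matrix.diagonal_neg]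
    congr 2 <;> (ext k; by_cases hk : (k : ℕ) + 1 = ℓ <;> simp [hk])

theorem sRun_mem (ℓ a r : ℕ) : ∀ g ∈ sRun ℓ a r, g ∈ normTorus ℓ := by
  intro g hg
  obtain ⟨k, -, rfl⟩ := List.mem_map.1 hg
  exact permElt_mem _

theorem cycleElt_mem (ℓ o r : ℕ) : cycleElt ℓ o r ∈ normTorus ℓ := by
  refine mul_mem (list_prod_mem (sRun_mem _ _ _)) (mul_mem (mul_mem
    (list_prod_mem (sRun_mem _ _ _)) (tLast_mem _)) (list_prod_mem fun g hg => ?_))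
  exact sRun_mem _ _ _ g (List.mem_reverse.1 hg)

theorem partsElt_mem (ℓ : ℕ) (L : List ℕ) : ∀ o, partsElt ℓ o L ∈ normTorus ℓ := by
  induction L with
  | nil => exact fun _ => one_mem _
  | cons r rs ih => exact fun o => mul_mem (cycleElt_mem _ _ _) (ih _)

theorem nElt_mem {ℓ : ℕ} (p : ℓ.Partition) : nElt p ∈ normTorus ℓ := partsElt_mem _ _ _

/-- The image of `n ∈ N(A)` in the Weyl group. -/
def toWeyl {ℓ : ℕ} (n : ↥(normTorus ℓ)) : Weyl ℓ := QuotientGroup.mk n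

/-- The conjugacy class of the Weyl group of type `C_ℓ` attached to a partition `p` of `ℓ`: the
class of the image of `nElt p` (signed permutations whose cycles are all negative, with
the parts of `p` as lengths). -/
def ellipticClass {ℓ : ℕ} (p : ℓ.Partition) : ConjClasses (Weyl ℓ) :=
  ConjClasses.mk (toWeyl ⟨nElt p, nElt_mem p⟩)

/-! ### The fundamental alcove of type `C_ℓ`

`V = ℝ^ℓ`, with simple roots `α_k = e_k - e_{k+1}` for `1 ≤ k < ℓ` and `α_ℓ = 2 e_ℓ`.  The nodes
of the affine Dynkin diagram `γ_0 ⇒ γ_1 — ⋯ — γ_{ℓ-1} ⇐ γ_ℓ` are indexed by `Fin (ℓ + 1)`. -/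

/-- The simple root `α_{k+1}`, as a function on `V` (`k` is 0-based). -/
def simpleRoot {ℓ : ℕ} (k : Fin ℓ) (v : Fin ℓ → ℝ) : ℝ :=
  if h : (k : ℕ) + 1 < ℓ then v k - v ⟨k + 1, h⟩ else 2 * v k

/-- The fundamental coweight dual to `α_{k+1}` (`k` is 0-based): `e_1 + ⋯ + e_{k+1}`, or
`(e_1 + ⋯ + e_ℓ) / 2` if `k + 1 = ℓ`. -/
def coweight {ℓ : ℕ} (k : Fin ℓ) : Fin ℓ → ℝ :=
  fun j => if j ≤ k then (if (k : ℕ) + 1 = ℓ then 1 / 2 else 1) else 0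

/-- The coefficient `b_γ = c_γ` at a node of the affine Dynkin diagram: `1, 2, 2, …, 2, 1`. -/
def nodeCoeff {ℓ : ℕ} (i : Fin (ℓ + 1)) : ℤ :=
  if (i : ℕ) = 0 ∨ (i : ℕ) = ℓ then 1 else 2

/-- The highest root `∑ c_γ γ = 2 α_1 + ⋯ + 2 α_{ℓ-1} + α_ℓ`. -/
def highestRoot {ℓ : ℕ} (v : Fin ℓ → ℝ) : ℝ :=
  ∑ k : Fin ℓ, (nodeCoeff k.succ : ℝ) * simpleRoot k v

/-- The closure of the fundamental alcove. -/
def closedAlcove (ℓ : ℕ) : Set (Fin ℓ → ℝ) :=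
  {v | (∀ k, 0 ≤ simpleRoot k v) ∧ highestRoot v ≤ 1}

/-! ### Kac diagrams

A semisimple group of type `C_ℓ` is presented as a group `G` with a surjective homomorphism
`π : Sp_{2ℓ} → G` with central kernel (`Sp_{2ℓ}` is simply connected).  Its maximal torus is
`π(A)`. -/

/-- The cocharacters of the torus `π(A)`, as a lattice in `V`: those `v` for which
`exp v = Diag(e^{2πi v_1}, …, e^{2πi v_ℓ}, e^{-2πi v_ℓ}, …, e^{-2πi v_1})` has trivial image
in `G`. -/
def IsCocharacter {ℓ : ℕ} {G : Type*} [Group G] (π : Sp ℓ →* G) (v : Fin ℓ → ℝ) : Prop :=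
  π (torusElt fun j => Units.mk0 (Complex.exp (2 * Real.pi * Complex.I * (v j : ℂ)))
    (Complex.exp_ne_zero _)) = 1

/-- The value of the cocharacter `v` of `π(A)` at `z`: the image in `G` of
`Diag(z^{v_1}, …, z^{v_ℓ}, z^{-v_ℓ}, …, z^{-v_1})`.  For a cocharacter `v`, another choice of
`log z` in the definition of the powers changes this matrix by an element of `ker π`. -/
def cocharValue {ℓ : ℕ} {G : Type*} [Group G] (π : Sp ℓ →* G) (v : Fin ℓ → ℝ) (z : ℂˣ) : G :=
  π (torusElt fun j => Units.mk0 ((z : ℂ) ^ ((v j : ℝ) : ℂ))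
    (by simp [Complex.cpow_eq_zero_iff]))

/-- Remove all common factors from a family of labels. -/
def removeCommonFactors {ι : Type*} [Fintype ι] (s : ι → ℤ) : ι → ℤ :=
  fun i => s i / Finset.univ.gcd s

/-- `d` is a Kac diagram for the element `g` of finite order `m` in `G`, with respect to the
primitive `m`-th root of unity `ξ`: there is a cocharacter `v` of the maximal torus such that `g` is
`G`-conjugate to `v(ξ)` and `x = v/m` is in the closure of the fundamental alcove, and `d`
is obtained by removing the common factors from the non-negative integers `s_γ` with
`x = (1/m) ∑_{k=1}^ℓ s_k ω̌_k` and `m = ∑_γ b_γ s_γ`. -/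
def IsKacDiagram {ℓ : ℕ} {G : Type*} [Group G] (π : Sp ℓ →* G) (ξ : ℂˣ) (g : G)
    (d : Fin (ℓ + 1) → ℤ) : Prop :=
  IsOfFinOrder g ∧ IsPrimitiveRoot ξ (orderOf g) ∧
  ∃ (v : Fin ℓ → ℝ) (s : Fin (ℓ + 1) → ℤ),
    IsCocharacter π v ∧
    IsConj g (cocharValue π v ξ) ∧
    (orderOf g : ℝ)⁻¹ • v ∈ closedAlcove ℓ ∧
    (∀ i, 0 ≤ s i) ∧
    (orderOf g : ℝ)⁻¹ • v = (orderOf g : ℝ)⁻¹ • ∑ k : Fin ℓ, (s k.succ : ℝ) • coweight k ∧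
    (orderOf g : ℤ) = ∑ i, nodeCoeff i * s i ∧
    d = removeCommonFactors s

/-! ### The explicit labels -/

/-- `m = 4 lcm(ℓ_1, …, ℓ_μ)`. -/
def bigM {ℓ : ℕ} (p : ℓ.Partition) : ℕ := 4 * p.parts.lcm

/-- The list of the numbers `(2a - 1) m / (4 ℓ_ν)`, `1 ≤ ν ≤ μ`, `1 ≤ a ≤ ℓ_ν`, in decreasing
order. -/
def sigmaList {ℓ : ℕ} (p : ℓ.Partition) : List ℕ :=
  (p.parts.bind fun r => (Finset.Icc 1 r).val.map fun a =>
    (2 * a - 1) * bigM p / (4 * r)).sort (· ≥ ·)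

/-- The `i`-th entry `σ_i` of the list, for `1 ≤ i ≤ ℓ`. -/
def sigma {ℓ : ℕ} (p : ℓ.Partition) (i : ℕ) : ℤ := ((sigmaList p).getD (i - 1) 0 : ℕ)

/-- The labels `m - 2σ_1, σ_1 - σ_2, …, σ_{ℓ-1} - σ_ℓ, 2σ_ℓ` at the nodes `γ_0, …, γ_ℓ`. -/
def labels {ℓ : ℕ} (p : ℓ.Partition) (i : Fin (ℓ + 1)) : ℤ :=
  if (i : ℕ) = 0 then bigM p - 2 * sigma p 1
  else if (i : ℕ) = ℓ then 2 * sigma p ℓ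
  else sigma p i - sigma p (i + 1)

end KacC

end

noncomputable section

namespace KacC

/-! A lift of an elliptic element with negative cycles of lengths `r` is determined up to conjugacy
whatever torus factor it carries. On a cycle through the basis vector `x`, `g ^ r` sends `x` to a
multiple of its partner, and invariance of the form then forces `g ^ (2r) x = -x`. Hence the
eigenvalues on that block are the `2r` distinct roots of `z ^ (2r) = -1`. Averaging along the orbit
gives eigenvectors, and after rescaling they form a symplectic basis. So `n` is conjugate to the
torus element with entries `η ^ σ_k` for every primitive `m`-th root `η`
(`isConj_torusElt_pow_sigmaFun`), and its order follows.

In `G` there are two extra points. The kernel of `π` lies in `{1, -1}`, so the order `M` of `π n`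
satisfies `m = M t` with `t ∣ 2`, and `M` is even because `4 ∣ m`. Also the spectrum of `n` is
stable under negation, as `σ ↦ m/2 - σ` permutes the exponents, so the sign lost under `π` does no
harm (`eigenvalues_neg`).

Existence: with `ξ = e^{2πik/M}` and `η = e^{2πik/m}`, the cocharacter `σ / t` takes at `ξ` the
value `π` of the diagonal form of `n`, and its labels are the stated ones divided by `t`.
Uniqueness: for any admissible cocharacter `v`, the numbers `t v_j` are integers in `[0, m/2]`,
decreasing, and the spectrum determines them as a multiset; hence `t v = σ`. -/

/-- The matrix action of `Sp_{2ℓ}` on column vectors. -/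
def act (ℓ : ℕ) : Sp ℓ →* Module.End ℂ (Fin ℓ ⊕ Fin ℓ → ℂ) :=
  (Matrix.toLinAlgEquiv' : Matrix (Fin ℓ ⊕ Fin ℓ) (Fin ℓ ⊕ Fin ℓ) ℂ ≃ₐ[ℂ] _).toMonoidHom.comp
    (Submonoid.subtype _)

theorem act_apply {ℓ : ℕ} (g : Sp ℓ) (v : Fin ℓ ⊕ Fin ℓ → ℂ) : act ℓ g v = g.1 *ᵥ v := rfl

/-- The basis vectors, with `(false, k)` for the `k`-th basis vector of the first half and
`(true, k)` for the one paired with it; it is zero for `k ≥ ℓ`. -/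
def vec (ℓ : ℕ) : Bool × ℕ → Fin ℓ ⊕ Fin ℓ → ℂ
  | (false, k) => Sum.elim (fun j => if (j : ℕ) = k then 1 else 0) 0
  | (true, k) => Sum.elim 0 (fun j => if (j : ℕ) = k then 1 else 0)

theorem vec_eq_zero {ℓ k : ℕ} (h : ℓ ≤ k) (b : Bool) : vec ℓ (b, k) = 0 := by
  have (j : Fin ℓ) : ¬ (j : ℕ) = k := by omega
  cases b <;> · ext (j | j) <;> simp [vec, this]

/-! ### Coordinate lines under the generators of the normalizer -/

/-- `g` maps the line of one basis vector into the line of another one. -/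
def Maps {ℓ : ℕ} (g : Sp ℓ) (x y : Bool × ℕ) : Prop := ∃ c : ℂ, act ℓ g (vec ℓ x) = c • vec ℓ y

theorem Maps.mul {ℓ : ℕ} {g h : Sp ℓ} {x y z : Bool × ℕ} (hg : Maps g y z) (hh : Maps h x y) :
    Maps (g * h) x z := by
  obtain ⟨c, hc⟩ := hg
  obtain ⟨d, hd⟩ := hh
  exact ⟨d * c, by rw [map_mul, Module.End.mul_apply, hd, map_smul, hc, smul_smul]⟩

theorem maps_one {ℓ : ℕ} (x : Bool × ℕ) : Maps (1 : Sp ℓ) x x := ⟨1, by simp⟩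

/-- Beyond the range the vector is zero, so statements about fixed lines need no upper bound on the
index. -/
theorem maps_of_le {ℓ k : ℕ} (g : Sp ℓ) (h : ℓ ≤ k) (b : Bool) (y : Bool × ℕ) :
    Maps g (b, k) y := ⟨0, by simp [vec_eq_zero h]⟩

theorem act_permElt {ℓ : ℕ} (τ : Equiv.Perm (Fin ℓ)) (v w : Fin ℓ → ℂ) :
    act ℓ (permElt τ) (Sum.elim v w) = Sum.elim (v ∘ τ) (w ∘ τ) := by
  have (u : Fin ℓ → ℂ) : τ.permMatrix ℂ *ᵥ u = u ∘ τ := by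
    ext i
    simp [Matrix.mulVec, dotProduct, Equiv.Perm.permMatrix, PEquiv.toMatrix_apply]
  simp [act_apply, permElt, Matrix.fromBlocks_mulVec, this, Function.comp_def]

/-- The permutation matrix acts by precomposition with `τ`, so lines move by the inverse of `τ`. -/
theorem maps_permElt {ℓ : ℕ} (τ : Equiv.Perm (Fin ℓ)) (b : Bool) (k : Fin ℓ) :
    Maps (permElt τ) (b, (τ k : ℕ)) (b, (k : ℕ)) := by
  refine ⟨1, ?_⟩
  cases b <;> simp only [vec, act_permElt] <;> ext (j | j) <;> simp [← Fin.ext_iff]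

theorem maps_sElt_left {ℓ k : ℕ} (h : k + 1 < ℓ) (b : Bool) :
    Maps (sElt ℓ k) (b, k) (b, k + 1) := by
  simpa [sElt, adjSwap, h] using maps_permElt (adjSwap ℓ k) b ⟨k + 1, h⟩

theorem maps_sElt_right {ℓ k : ℕ} (h : k + 1 < ℓ) (b : Bool) :
    Maps (sElt ℓ k) (b, k + 1) (b, k) := by
  simpa [sElt, adjSwap, h] using maps_permElt (adjSwap ℓ k) b ⟨k, by omega⟩

theorem maps_sElt_of_ne {ℓ k j : ℕ} (h₁ : j ≠ k) (h₂ : j ≠ k + 1) (b : Bool) :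
    Maps (sElt ℓ k) (b, j) (b, j) := by
  rcases lt_or_ge j ℓ with hj | hj
  · have key : adjSwap ℓ k ⟨j, hj⟩ = ⟨j, hj⟩ := by
      rw [adjSwap]
      split_ifs with h
      · exact Equiv.swap_apply_of_ne_of_ne (by simpa using h₁) (by simpa using h₂)
      · rfl
    simpa [sElt, key] using maps_permElt (adjSwap ℓ k) b ⟨j, hj⟩
  · exact maps_of_le _ hj _ _

theorem maps_tLast {ℓ k : ℕ} (h : k + 1 = ℓ) (b : Bool) :
    Maps (tLast ℓ) (b, k) (!b, k) := by
  refine ⟨if b then 1 else -1, ?_⟩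
  cases b <;> ext (j | j) <;>
    by_cases hj : (j : ℕ) = k <;>
    simp [vec, act_apply, tLast, Matrix.fromBlocks_mulVec, Matrix.mulVec_diagonal, hj, h,
      -Matrix.fromBlocks_diagonal]

theorem maps_tLast_of_ne {ℓ k : ℕ} (h : k + 1 ≠ ℓ) (b : Bool) :
    Maps (tLast ℓ) (b, k) (b, k) := by
  refine ⟨1, ?_⟩
  cases b <;> ext (j | j) <;>
    by_cases hj : (j : ℕ) = k <;>
    simp [vec, act_apply, tLast, Matrix.fromBlocks_mulVec, Matrix.mulVec_diagonal, hj, h,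
      -Matrix.fromBlocks_diagonal]

theorem maps_torus {ℓ : ℕ} {a : Sp ℓ} (ha : a ∈ torus ℓ) (x : Bool × ℕ) : Maps a x x := by
  obtain ⟨b, k⟩ := x
  rcases lt_or_ge k ℓ with hk | hk
  · obtain ⟨d, e, h⟩ := (mem_torus_iff a).1 ha
    refine ⟨if b then e ⟨k, hk⟩ else d ⟨k, hk⟩, ?_⟩
    cases b <;> ext (j | j) <;>
      by_cases hj : (j : ℕ) = k <;>
      simp [vec, act_apply, h, Matrix.fromBlocks_mulVec, Matrix.mulVec_diagonal, hj,
        -Matrix.fromBlocks_diagonal]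
    all_goals simp [← hj]
  · exact maps_of_le _ hk _ _

theorem sRun_succ (ℓ o r : ℕ) : sRun ℓ o (r + 1) = sElt ℓ o :: sRun ℓ (o + 1) r := by
  simp [sRun, List.range'_succ]

theorem maps_sRun_last {ℓ r : ℕ} (b : Bool) : ∀ o, o + r < ℓ →
    Maps (sRun ℓ o r).prod (b, o + r) (b, o) := by
  induction r with
  | zero => exact fun o _ => by simpa [sRun] using maps_one _
  | succ r ih =>
    intro o h
    rw [sRun_succ, List.prod_cons]
    refine (maps_sElt_right (by omega) b).mul ?_
    convert ih (o + 1) (by omega) using 2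
    omega

theorem maps_sRun_of_notMem {ℓ r j : ℕ} (b : Bool) : ∀ o, (j < o ∨ o + r < j) →
    Maps (sRun ℓ o r).prod (b, j) (b, j) := by
  induction r with
  | zero => exact fun o _ => by simpa [sRun] using maps_one _
  | succ r ih =>
    intro o h
    rw [sRun_succ, List.prod_cons]
    exact (maps_sElt_of_ne (by omega) (by omega) b).mul (ih (o + 1) (by omega))

theorem maps_sRun_shift {ℓ r j : ℕ} (b : Bool) : ∀ o, o + r < ℓ → o ≤ j → j < o + r →
    Maps (sRun ℓ o r).prod (b, j) (b, j + 1) := by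
  induction r with
  | zero => intros; omega
  | succ r ih =>
    intro o h h₁ h₂
    rw [sRun_succ, List.prod_cons]
    rcases eq_or_lt_of_le h₁ with rfl | h₁
    · exact (maps_sElt_left (by omega) b).mul (maps_sRun_of_notMem b _ (by omega))
    · exact (maps_sElt_of_ne (by omega) (by omega) b).mul (ih (o + 1) (by omega) h₁ (by omega))

theorem maps_sRun_reverse_first {ℓ r : ℕ} (b : Bool) : ∀ o, o + r < ℓ →
    Maps (sRun ℓ o r).reverse.prod (b, o) (b, o + r) := by
  induction r with
  | zero => exact fun o _ => by simpa [sRun] using maps_one _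
  | succ r ih =>
    intro o h
    rw [sRun_succ, List.reverse_cons, List.prod_append, List.prod_singleton]
    refine Maps.mul ?_ (maps_sElt_left (by omega) b)
    convert ih (o + 1) (by omega) using 2
    omega

theorem maps_sRun_reverse_of_notMem {ℓ r j : ℕ} (b : Bool) : ∀ o, (j < o ∨ o + r < j) →
    Maps (sRun ℓ o r).reverse.prod (b, j) (b, j) := by
  induction r with
  | zero => exact fun o _ => by simpa [sRun] using maps_one _
  | succ r ih =>
    intro o h
    rw [sRun_succ, List.reverse_cons, List.prod_append, List.prod_singleton]
    exact (ih (o + 1) (by omega)).mul (maps_sElt_of_ne (by omega) (by omega) b)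

theorem maps_sRun_reverse_shift {ℓ r j : ℕ} (b : Bool) : ∀ o, o + r < ℓ → o ≤ j → j < o + r →
    Maps (sRun ℓ o r).reverse.prod (b, j + 1) (b, j) := by
  induction r with
  | zero => intros; omega
  | succ r ih =>
    intro o h h₁ h₂
    rw [sRun_succ, List.reverse_cons, List.prod_append, List.prod_singleton]
    rcases eq_or_lt_of_le h₁ with rfl | h₁
    · exact (maps_sRun_reverse_of_notMem b _ (by omega)).mul (maps_sElt_right (by omega) b)
    · exact (ih (o + 1) (by omega) h₁ (by omega)).mul
        (maps_sElt_of_ne (by omega) (by omega) b)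

/-- The reversed run carries the line to the last position, `tLast` exchanges it with its partner,
and the run carries it back. -/
theorem maps_tElt {ℓ k : ℕ} (h : k < ℓ) (b : Bool) : Maps (tElt ℓ k) (b, k) (!b, k) := by
  have hk : k + (ℓ - 1 - k) + 1 = ℓ := by omega
  exact ((maps_sRun_last (!b) k (by omega)).mul (maps_tLast hk b)).mul
    (maps_sRun_reverse_first b k (by omega))

theorem maps_tElt_of_ne {ℓ k j : ℕ} (h : k < ℓ) (hj : j ≠ k) (b : Bool) :
    Maps (tElt ℓ k) (b, j) (b, j) := by
  rcases lt_or_ge j ℓ with hjl | hjl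
  · rcases lt_or_gt_of_ne hj with hj | hj
    · exact ((maps_sRun_of_notMem b k (.inl hj)).mul (maps_tLast_of_ne (by omega) b)).mul
        (maps_sRun_reverse_of_notMem b k (.inl hj))
    · obtain ⟨i, rfl⟩ : ∃ i, j = i + 1 := ⟨j - 1, by omega⟩
      exact ((maps_sRun_shift b k (by omega) (by omega) (by omega)).mul
        (maps_tLast_of_ne (by omega) b)).mul
        (maps_sRun_reverse_shift b k (by omega) (by omega) (by omega))
  · exact maps_of_le _ hjl _ _

/-! ### Negative cycles -/

/-- `g` permutes the lines of the basis vectors with indices in `[o, o + r)`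
by a negative cycle. -/
structure IsNegCycle {ℓ : ℕ} (g : Sp ℓ) (o r : ℕ) : Prop where
  shift : ∀ b j, o ≤ j → j + 1 < o + r → Maps g (b, j) (b, j + 1)
  last : ∀ b, Maps g (b, o + r - 1) (!b, o)

/-- The right factor acts first: it flips the last line only, and the run then advances every other
line of the block and returns the last one to the start. -/
theorem isNegCycle_cycleElt {ℓ o r : ℕ} (hr : 0 < r) (h : o + r ≤ ℓ) :
    IsNegCycle (cycleElt ℓ o r) o r where
  shift b j h₁ h₂ := (maps_sRun_shift b o (by omega) h₁ (by omega)).mul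
    (maps_tElt_of_ne (k := o + r - 1) (by omega) (by omega) b)
  last b := by
    refine Maps.mul ?_ (maps_tElt (k := o + r - 1) (by omega) b)
    convert maps_sRun_last (ℓ := ℓ) (!b) o (r := r - 1) (by omega) using 2
    omega

theorem maps_cycleElt_of_notMem {ℓ o r j : ℕ} (hr : 0 < r) (h : o + r ≤ ℓ)
    (hj : j < o ∨ o + r ≤ j) (b : Bool) : Maps (cycleElt ℓ o r) (b, j) (b, j) :=
  (maps_sRun_of_notMem b o (by omega)).mul
    (maps_tElt_of_ne (k := o + r - 1) (by omega) (by omega) b)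

theorem maps_partsElt_of_lt {ℓ j : ℕ} (b : Bool) (L : List ℕ) : ∀ o, (∀ r ∈ L, 0 < r) →
    o + L.sum ≤ ℓ → j < o → Maps (partsElt ℓ o L) (b, j) (b, j) := by
  induction L with
  | nil => exact fun _ _ _ _ => maps_one _
  | cons r L ih =>
    intro o hL ho hj
    rw [List.sum_cons] at ho
    exact (maps_cycleElt_of_notMem (hL r (by simp)) (by omega) (.inl hj) b).mul
      (ih (o + r) (fun s hs => hL s (by simp [hs])) (by omega) (by omega))

/-- The factors of the other parts fix every line of this block, so only one factor matters. -/
theorem isNegCycle_partsElt {ℓ r : ℕ} (L₁ L₂ : List ℕ) : ∀ o, (∀ s ∈ L₁ ++ r :: L₂, 0 < s) →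
    o + (L₁ ++ r :: L₂).sum ≤ ℓ →
    IsNegCycle (partsElt ℓ o (L₁ ++ r :: L₂)) (o + L₁.sum) r := by
  induction L₁ with
  | nil =>
    intro o hL ho
    have hr := hL r (by simp)
    simp only [List.nil_append, List.sum_cons] at ho
    have hc := isNegCycle_cycleElt (ℓ := ℓ) (o := o) hr (by omega)
    have hf (b j) (hj : j < o + r) : Maps (partsElt ℓ (o + r) L₂) (b, j) (b, j) :=
      maps_partsElt_of_lt b L₂ (o + r) (fun s hs => hL s (by simp [hs])) (by omega) hj
    exact ⟨fun b j h₁ h₂ => (hc.shift b j h₁ h₂).mul (hf b j (by simp at h₂; omega)),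
      fun b => (hc.last b).mul (hf b _ (by simp; omega))⟩
  | cons s L₁ ih =>
    intro o hL ho
    simp only [List.cons_append, List.sum_cons, List.sum_append] at ho
    have hs := hL s (by simp)
    have hr := hL r (by simp)
    have hc := ih (o + s) (fun t ht => hL t (by simp at ht ⊢; tauto))
      (by simp only [List.sum_cons, List.sum_append]; omega)
    have hf (b j) (hj : o + s ≤ j) : Maps (cycleElt ℓ o s) (b, j) (b, j) :=
      maps_cycleElt_of_notMem hs (by omega) (.inr hj) b
    rw [List.sum_cons, ← add_assoc]
    exact ⟨fun b j h₁ h₂ => (hf b _ (by omega)).mul (hc.shift b j h₁ h₂),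
      fun b => (hf _ _ (by omega)).mul (hc.last b)⟩

/-- Torus elements only rescale basis vectors. This is why any lift of the Weyl group element can be
treated. -/
theorem IsNegCycle.mul_torus {ℓ o r : ℕ} {g a : Sp ℓ} (hg : IsNegCycle g o r)
    (ha : a ∈ torus ℓ) : IsNegCycle (g * a) o r :=
  ⟨fun b j h₁ h₂ => (hg.shift b j h₁ h₂).mul (maps_torus ha _),
    fun b => (hg.last b).mul (maps_torus ha _)⟩

/-! ### The alternating form, orbits and eigenvectors -/

/-- The alternating form preserved by `Sp_{2ℓ}`. -/
def form (ℓ : ℕ) : LinearMap.BilinForm ℂ (Fin ℓ ⊕ Fin ℓ → ℂ) := (Matrix.J (Fin ℓ) ℂ).toBilin'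

theorem form_apply {ℓ : ℕ} (v w : Fin ℓ ⊕ Fin ℓ → ℂ) :
    form ℓ v w = v ⬝ᵥ Matrix.J (Fin ℓ) ℂ *ᵥ w := Matrix.toBilin'_apply' _ _ _

theorem form_act {ℓ : ℕ} (g : Sp ℓ) (v w : Fin ℓ ⊕ Fin ℓ → ℂ) :
    form ℓ (act ℓ g v) (act ℓ g w) = form ℓ v w := by
  rw [form_apply, form_apply, act_apply, act_apply, ← Matrix.vecMul_transpose,
    ← Matrix.dotProduct_mulVec, Matrix.mulVec_mulVec, Matrix.mulVec_mulVec,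
    SymplecticGroup.mem_iff'.1 g.2]

theorem form_swap {ℓ : ℕ} (v w : Fin ℓ ⊕ Fin ℓ → ℂ) : form ℓ v w = -form ℓ w v := by
  rw [form_apply, form_apply, Matrix.dotProduct_mulVec, ← Matrix.mulVec_transpose,
    Matrix.J_transpose, Matrix.neg_mulVec, neg_dotProduct, dotProduct_comm]

theorem form_elim {ℓ : ℕ} (v v' w w' : Fin ℓ → ℂ) :
    form ℓ (Sum.elim v v') (Sum.elim w w') = v' ⬝ᵥ w - v ⬝ᵥ w' := by
  simp [form_apply, Matrix.J, Matrix.fromBlocks_mulVec, Matrix.neg_mulVec, sub_eq_neg_add]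

theorem form_vec_self {ℓ : ℕ} (b : Bool) (j k : ℕ) : form ℓ (vec ℓ (b, j)) (vec ℓ (b, k)) = 0 := by
  cases b <;> simp [vec, form_elim]

theorem form_vec_of_ne {ℓ : ℕ} (b c : Bool) {j k : ℕ} (h : j ≠ k) :
    form ℓ (vec ℓ (b, j)) (vec ℓ (c, k)) = 0 := by
  cases b <;> cases c <;> simp only [vec, form_elim, dotProduct] <;>
    simp only [Pi.zero_apply, mul_zero, zero_mul, Finset.sum_const_zero, sub_self, zero_sub,
      sub_zero, neg_eq_zero] <;>
    exact Finset.sum_eq_zero fun i _ => by split_ifs <;> simp_all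

theorem form_vec_true_false {ℓ j : ℕ} (h : j < ℓ) :
    form ℓ (vec ℓ (true, j)) (vec ℓ (false, j)) = 1 := by
  simp only [vec, form_elim, dotProduct]
  rw [Finset.sum_eq_single ⟨j, h⟩] <;> simp +contextual [Fin.ext_iff]

theorem act_inv_act {ℓ : ℕ} (g : Sp ℓ) (v : Fin ℓ ⊕ Fin ℓ → ℂ) : act ℓ g⁻¹ (act ℓ g v) = v := by
  rw [← Module.End.mul_apply, ← map_mul, inv_mul_cancel, map_one, Module.End.one_apply]

theorem IsNegCycle.maps_pow {ℓ o r : ℕ} {g : Sp ℓ} (hg : IsNegCycle g o r) (b : Bool) {j : ℕ}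
    (hj : j < r) : Maps (g ^ j) (b, o) (b, o + j) := by
  induction j with
  | zero => exact maps_one _
  | succ j ih =>
    rw [pow_succ']
    exact (hg.shift b (o + j) (by omega) (by omega)).mul (ih (by omega))

theorem IsNegCycle.maps_pow_self {ℓ o r : ℕ} {g : Sp ℓ} (hg : IsNegCycle g o r) (hr : 0 < r)
    (b : Bool) : Maps (g ^ r) (b, o) (!b, o) := by
  obtain ⟨s, rfl⟩ : ∃ s, r = s + 1 := ⟨r - 1, by omega⟩
  rw [pow_succ']
  exact (hg.last b).mul (hg.maps_pow b (by omega))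

/-- The orbit runs once through each half of the block; it meets the partner line of the starting
vector only at `j = r`, the one place where the pairing can be nonzero. -/
theorem IsNegCycle.exists_maps_pow {ℓ o r : ℕ} {g : Sp ℓ} (hg : IsNegCycle g o r) {j : ℕ}
    (hj : j < 2 * r) : ∃ b k, k < r ∧ (k = 0 → b = true → j = r) ∧
      Maps (g ^ j) (false, o) (b, o + k) := by
  rcases lt_or_ge j r with h | h
  · exact ⟨false, j, h, by simp, hg.maps_pow _ h⟩
  · obtain ⟨k, rfl⟩ : ∃ k, j = k + r := ⟨j - r, by omega⟩
    refine ⟨true, k, by omega, by simp, ?_⟩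
    rw [pow_add]
    exact (hg.maps_pow true (by omega)).mul (hg.maps_pow_self (by omega) false)

/-- The first `2r` vectors of the orbit of `x` under `g` form, up to scalars, a symplectic basis,
and `g ^ (2r)` maps `x` to `-x`. -/
structure IsNegOrbit {ℓ : ℕ} (g : Sp ℓ) (r : ℕ) (x : Fin ℓ ⊕ Fin ℓ → ℂ) : Prop where
  pow_apply : act ℓ (g ^ (2 * r)) x = -x
  form_eq_zero : ∀ j < 2 * r, j ≠ r → form ℓ x (act ℓ (g ^ j) x) = 0
  form_ne_zero : form ℓ x (act ℓ (g ^ r) x) ≠ 0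

theorem IsNegCycle.isNegOrbit {ℓ o r : ℕ} {g : Sp ℓ} (hg : IsNegCycle g o r) (hr : 0 < r)
    (ho : o + r ≤ ℓ) : IsNegOrbit g r (vec ℓ (false, o)) := by
  obtain ⟨c, hc⟩ := hg.maps_pow_self hr false
  obtain ⟨d, hd⟩ := (hg.maps_pow_self hr true).mul (hg.maps_pow_self hr false)
  rw [Bool.not_false] at hc
  rw [Bool.not_true, ← pow_add, ← two_mul] at hd
  have h1 := form_vec_true_false (show o < ℓ by omega)
  have h2 : form ℓ (vec ℓ (false, o)) (vec ℓ (true, o)) = -1 := by rw [form_swap, h1]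
  have hc0 : c ≠ 0 := by
    rintro rfl
    have := act_inv_act (g ^ r) (vec ℓ (false, o))
    rw [hc, zero_smul, map_zero] at this
    rw [← this] at h1
    simp at h1
  -- With `g ^ r x = c x'` and `g ^ (2r) x = d x`, invariance of the pairing of `x` with `g ^ r x`
  -- reads `c d = -c`, so `d = -1` whatever `c` is.
  have hcd := form_act (g ^ r) (vec ℓ (false, o)) (act ℓ (g ^ r) (vec ℓ (false, o)))
  rw [← Module.End.mul_apply, ← map_mul, ← pow_add, ← two_mul, hd, hc] at hcd
  simp only [map_smul, LinearMap.smul_apply, h1, h2, smul_eq_mul] at hcd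
  have hd1 : d = -1 := mul_left_cancel₀ hc0 (by linear_combination hcd)
  refine ⟨by rw [hd, hd1, neg_one_smul], fun j hj hjr => ?_, by rw [hc, map_smul, h2]; simp [hc0]⟩
  obtain ⟨b, k, -, hk, a, ha⟩ := hg.exists_maps_pow hj
  rw [ha, map_smul]
  rcases Nat.eq_zero_or_pos k with rfl | hk0
  · cases b
    · simp [form_vec_self]
    · exact absurd (hk rfl rfl) hjr
  · rw [form_vec_of_ne _ _ (by omega), smul_zero]

theorem IsNegCycle.form_eq_zero {ℓ o r o' : ℕ} {g : Sp ℓ} (hg : IsNegCycle g o r)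
    (h : o' < o ∨ o + r ≤ o') {j : ℕ} (hj : j < 2 * r) :
    form ℓ (vec ℓ (false, o')) (act ℓ (g ^ j) (vec ℓ (false, o))) = 0 := by
  obtain ⟨b, k, hk, -, a, ha⟩ := hg.exists_maps_pow hj
  rw [ha, map_smul, form_vec_of_ne _ _ (by omega), smul_zero]

/-- A multiple of the projection of `x` to the eigenspace of `g` for the eigenvalue `z`, when
`g ^ (2r)` maps `x` to `-x` and `z ^ (2r) = -1`. -/
def eigenvec {ℓ : ℕ} (g : Sp ℓ) (r : ℕ) (x : Fin ℓ ⊕ Fin ℓ → ℂ) (z : ℂˣ) : Fin ℓ ⊕ Fin ℓ → ℂ :=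
  ∑ j ∈ Finset.range (2 * r), ((z⁻¹ : ℂˣ) : ℂ) ^ j • act ℓ (g ^ j) x

theorem act_eigenvec {ℓ r : ℕ} {g : Sp ℓ} {x : Fin ℓ ⊕ Fin ℓ → ℂ} {z : ℂˣ}
    (hx : act ℓ (g ^ (2 * r)) x = -x) (hz : z ^ (2 * r) = -1) :
    act ℓ g (eigenvec g r x z) = (z : ℂ) • eigenvec g r x z := by
  have hz' : ((z⁻¹ : ℂˣ) : ℂ) ^ (2 * r) = -1 := by
    rw [← Units.val_pow_eq_pow_val, inv_pow, hz, inv_neg, inv_one, Units.val_neg, Units.val_one]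
  -- The sum over `2r + 1` terms is split at either end. The extra last term equals the first, since
  -- the signs of `z ^ (-2r)` and `g ^ (2r) x` cancel; so shifting the index leaves the sum
  -- unchanged.
  have key := (Finset.sum_range_succ' (fun j => ((z⁻¹ : ℂˣ) : ℂ) ^ j • act ℓ (g ^ j) x)
    (2 * r)).symm.trans (Finset.sum_range_succ _ _)
  simp only [hz', hx, pow_zero, map_one, Module.End.one_apply, one_smul, neg_smul, smul_neg,
    neg_neg, add_left_inj] at key
  rw [eigenvec]
  conv_rhs => rw [← key]
  rw [map_sum, Finset.smul_sum]
  refine Finset.sum_congr rfl fun j _ => ?_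
  rw [map_smul, smul_smul, pow_succ', ← mul_assoc, Units.mul_inv, one_mul, pow_succ' g, map_mul,
    Module.End.mul_apply]

theorem form_eq_zero_of_eigen {ℓ : ℕ} {g : Sp ℓ} {v w : Fin ℓ ⊕ Fin ℓ → ℂ} {y z : ℂˣ}
    (hv : act ℓ g v = (y : ℂ) • v) (hw : act ℓ g w = (z : ℂ) • w) (h : y * z ≠ 1) :
    form ℓ v w = 0 := by
  have := form_act g v w
  rw [hv, hw, map_smul, map_smul, LinearMap.smul_apply, smul_smul, smul_eq_mul, ← Units.val_mul,
    mul_comm z y] at this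
  by_contra h0
  exact h (Units.ext (mul_right_cancel₀ h0 (by rw [this, Units.val_one, one_mul])))

theorem act_pow_eigen {ℓ : ℕ} {g : Sp ℓ} {w : Fin ℓ ⊕ Fin ℓ → ℂ} {z : ℂˣ}
    (hw : act ℓ g w = (z : ℂ) • w) (i : ℕ) : act ℓ (g ^ i) w = (z : ℂ) ^ i • w := by
  induction i with
  | zero => simp
  | succ i ih =>
    rw [pow_succ', map_mul, Module.End.mul_apply, ih, map_smul, hw, smul_smul, ← pow_succ]

/-- By invariance each power of `g` passes to the eigenvector `w`, where it becomes a scalar; a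
geometric sum remains. -/
theorem form_eigenvec_left {ℓ r : ℕ} {g : Sp ℓ} {x w : Fin ℓ ⊕ Fin ℓ → ℂ} {y z : ℂˣ}
    (hw : act ℓ g w = (z : ℂ) • w) :
    form ℓ (eigenvec g r x y) w =
      (∑ i ∈ Finset.range (2 * r), (((y * z)⁻¹ : ℂˣ) : ℂ) ^ i) * form ℓ x w := by
  rw [eigenvec, map_sum, LinearMap.sum_apply, Finset.sum_mul]
  refine Finset.sum_congr rfl fun i _ => ?_
  have h := form_act (g ^ i) x w
  rw [act_pow_eigen hw, map_smul, smul_eq_mul] at h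
  rw [map_smul, LinearMap.smul_apply, smul_eq_mul, ← h, mul_inv, Units.val_mul, mul_pow, mul_assoc,
    ← mul_assoc (((z⁻¹ : ℂˣ) : ℂ) ^ i), ← mul_pow, Units.inv_mul, one_pow, one_mul]

theorem form_eigenvec_right_eq_zero {ℓ r : ℕ} {g : Sp ℓ} {x x' : Fin ℓ ⊕ Fin ℓ → ℂ} {z : ℂˣ}
    (h : ∀ j < 2 * r, form ℓ x' (act ℓ (g ^ j) x) = 0) :
    form ℓ x' (eigenvec g r x z) = 0 := by
  rw [eigenvec, map_sum]
  exact Finset.sum_eq_zero fun j hj => by rw [map_smul, h j (Finset.mem_range.1 hj), smul_zero]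

/-- For inverse eigenvalues the geometric sum is `2r`, and in the second argument only the term `j =
r` pairs nontrivially with `x`. -/
theorem IsNegOrbit.form_eigenvec_ne_zero {ℓ r : ℕ} {g : Sp ℓ} {x : Fin ℓ ⊕ Fin ℓ → ℂ}
    (hx : IsNegOrbit g r x) (hr : 0 < r) {z : ℂˣ} (hz : z ^ (2 * r) = -1) :
    form ℓ (eigenvec g r x z) (eigenvec g r x z⁻¹) ≠ 0 := by
  rw [form_eigenvec_left (act_eigenvec hx.pow_apply (by rw [inv_pow, hz, inv_neg, inv_one]))]
  have : form ℓ x (eigenvec g r x z⁻¹) = (z : ℂ) ^ r * form ℓ x (act ℓ (g ^ r) x) := by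
    rw [eigenvec, map_sum, Finset.sum_eq_single r]
    · simp
    · intro j hj hjr
      rw [map_smul, hx.form_eq_zero j (Finset.mem_range.1 hj) hjr, smul_zero]
    · simp [hr]
  rw [this]
  refine mul_ne_zero ?_ (mul_ne_zero (pow_ne_zero _ z.ne_zero) hx.form_ne_zero)
  simp [hr.ne']

/-! ### Symplectic diagonalization -/

theorem coe_torusElt {ℓ : ℕ} (a : Fin ℓ → ℂˣ) :
    (torusElt a : Matrix (Fin ℓ ⊕ Fin ℓ) (Fin ℓ ⊕ Fin ℓ) ℂ) =
      Matrix.diagonal (Sum.elim (fun k => (a k : ℂ)) fun k => ((a k)⁻¹ : ℂˣ)) := by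
  simp [torusElt]

/-- An element of the symplectic group with a symplectic basis of eigenvectors is conjugate to a
diagonal matrix. -/
theorem isConj_torusElt_of_eigenbasis {ℓ : ℕ} (g : Sp ℓ) (a : Fin ℓ → ℂˣ)
    (B : Fin ℓ ⊕ Fin ℓ → Fin ℓ ⊕ Fin ℓ → ℂ)
    (hB : ∀ i j, form ℓ (B i) (B j) = Matrix.J (Fin ℓ) ℂ i j)
    (hl : ∀ k, act ℓ g (B (.inl k)) = (a k : ℂ) • B (.inl k))
    (hr : ∀ k, act ℓ g (B (.inr k)) = ((a k)⁻¹ : ℂˣ) • B (.inr k)) :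
    IsConj g (torusElt a) := by
  have hmem : (Matrix.of B)ᵀ ∈ Matrix.symplecticGroup (Fin ℓ) ℂ := by
    rw [SymplecticGroup.mem_iff', Matrix.transpose_transpose]
    ext i j
    rw [← hB, form_apply, Matrix.mul_assoc]
    rfl
  refine IsConj.symm (isConj_iff.2 ⟨⟨_, hmem⟩, ?_⟩)
  rw [mul_inv_eq_iff_eq_mul]
  ext i j
  change ((Matrix.of B)ᵀ * (torusElt a).1) i j = (act ℓ g (B j)) i
  rw [coe_torusElt, Matrix.mul_diagonal]
  rcases j with j | j
  · rw [hl]; simp [mul_comm]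
  · rw [hr]; simp [mul_comm, Units.smul_def]

/-- An element of the symplectic group with a decomposition into orbits as in `IsNegOrbit` is
conjugate to a diagonal matrix with specified entries. -/
theorem isConj_torusElt_of_negOrbits {ℓ : ℕ} {ι : Type*} {g : Sp ℓ} (r : ι → ℕ)
    (x : ι → Fin ℓ ⊕ Fin ℓ → ℂ) (hr : ∀ ν, 0 < r ν) (hx : ∀ ν, IsNegOrbit g (r ν) (x ν))
    (horth : ∀ ν ν', ν ≠ ν' → ∀ j < 2 * r ν', form ℓ (x ν) (act ℓ (g ^ j) (x ν')) = 0)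
    (e : Fin ℓ → ι) (z : Fin ℓ → ℂˣ) (hz : ∀ k, z k ^ (2 * r (e k)) = -1)
    (hz₁ : ∀ k k', e k = e k' → z k * z k' ≠ 1)
    (hz₂ : ∀ k k', e k = e k' → k ≠ k' → z k ≠ z k') : IsConj g (torusElt z) := by
  have hz' : ∀ k, (z k)⁻¹ ^ (2 * r (e k)) = -1 := fun k => by rw [inv_pow, hz, inv_neg, inv_one]
  set u : Fin ℓ → ℂˣ → Fin ℓ ⊕ Fin ℓ → ℂ := fun k y => eigenvec g (r (e k)) (x (e k)) y
  have hu : ∀ k y, y ^ (2 * r (e k)) = -1 → act ℓ g (u k y) = (y : ℂ) • u k y :=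
    fun k y hy => act_eigenvec (hx _).pow_apply hy
  have h0 : ∀ k k' y y', y ^ (2 * r (e k)) = -1 → y' ^ (2 * r (e k')) = -1 →
      (e k = e k' → y * y' ≠ 1) → form ℓ (u k y) (u k' y') = 0 := by
    intro k k' y y' hy hy' hne
    by_cases hk : e k = e k'
    · exact form_eq_zero_of_eigen (hu k y hy) (hu k' y' hy') (hne hk)
    · rw [form_eigenvec_left (hu k' y' hy'), form_eigenvec_right_eq_zero (horth _ _ hk), mul_zero]
  -- Rescaling the second half of the basis makes the pairings `-1`, the upper right block of
  -- `Matrix.J`.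
  set c : Fin ℓ → ℂ := fun k => -(form ℓ (u k (z k)) (u k (z k)⁻¹))⁻¹
  have h1 : ∀ k k', form ℓ (u k (z k)) (c k' • u k' (z k')⁻¹) = if k = k' then -1 else 0 := by
    intro k k'
    split_ifs with hk
    · subst hk
      have := (hx (e k)).form_eigenvec_ne_zero (hr _) (hz k)
      rw [map_smul, smul_eq_mul, neg_mul, inv_mul_cancel₀ this]
    · rw [map_smul, h0 _ _ _ _ (hz k) (hz' k'), smul_zero]
      intro hkk' h
      exact hz₂ k k' hkk' hk (mul_inv_eq_one.1 h)
  refine isConj_torusElt_of_eigenbasis g z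
    (Sum.elim (fun k => u k (z k)) (fun k => c k • u k (z k)⁻¹)) ?_ ?_ ?_
  · rintro (k | k) (k' | k') <;>
      simp only [Sum.elim_inl, Sum.elim_inr, Matrix.J, Matrix.fromBlocks_apply₁₁,
        Matrix.fromBlocks_apply₁₂, Matrix.fromBlocks_apply₂₁, Matrix.fromBlocks_apply₂₂]
    · exact h0 _ _ _ _ (hz k) (hz k') (hz₁ k k')
    · rw [h1, Matrix.neg_apply, Matrix.one_apply]; split_ifs <;> simp
    · rw [form_swap, h1, Matrix.one_apply]; simp only [eq_comm (a := k)]; split_ifs <;> simp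
    · rw [map_smul, map_smul, LinearMap.smul_apply, h0 _ _ _ _ (hz' k) (hz' k')]
      · simp
      · intro hk h
        rw [← mul_inv, inv_eq_one] at h
        exact hz₁ k k' hk h
  · exact fun k => hu k _ (hz k)
  · intro k
    simp only [Sum.elim_inr]
    rw [map_smul, hu k _ (hz' k), smul_comm]
    rfl

/-! ### From the elliptic class to the exponents -/

/-- A conjugating element of the Weyl group lifts to the normalizer, and equality of cosets leaves a
torus factor. -/
theorem exists_isConj_nElt_mul {ℓ : ℕ} {p : ℓ.Partition} {n : ↥(normTorus ℓ)}
    (hn : ConjClasses.mk (toWeyl n) = ellipticClass p) :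
    ∃ a ∈ torus ℓ, IsConj (n : Sp ℓ) (nElt p * a) := by
  obtain ⟨c, hc⟩ := isConj_iff.1 (ConjClasses.mk_eq_mk_iff_isConj.1 hn)
  obtain ⟨w, rfl⟩ := QuotientGroup.mk_surjective c
  have := QuotientGroup.eq.1 (show ((⟨nElt p, nElt_mem p⟩ : ↥(normTorus ℓ)) : Weyl ℓ) =
    ((w * n * w⁻¹ : ↥(normTorus ℓ)) : Weyl ℓ) from hc.symm)
  exact ⟨_, this, isConj_iff.2 ⟨w, by simp⟩⟩

/-- Equal multiplicities mean equinumerous fibres, and bijections of fibres glue. -/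
theorem exists_equiv_of_map_univ_eq {α β γ : Type*} [Fintype α] [Fintype β] (f : α → γ) (g : β → γ)
    (h : Finset.univ.val.map f = Finset.univ.val.map g) : ∃ e : α ≃ β, ∀ a, g (e a) = f a := by
  classical
  have (c : γ) : Fintype.card {a // f a = c} = Fintype.card {b // g b = c} := by
    have := congrArg (Multiset.count c) h
    simp only [Multiset.count_map] at this
    simp only [Fintype.card_subtype, Finset.card_def, Finset.filter_val]
    simpa only [eq_comm (a := c)] using this
  exact ⟨Equiv.ofFiberEquiv fun c => Fintype.equivOfCardEq (this c),
    fun a => Equiv.ofFiberEquiv_map _ a⟩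

/-- The sequence `σ_1, …, σ_ℓ`, indexed from `0`. -/
def sigmaFun {ℓ : ℕ} (p : ℓ.Partition) (k : Fin ℓ) : ℕ := (sigmaList p).getD k 0

theorem map_univ_eq_finset_sum {α β : Type*} [Fintype α] (f : α → β) :
    Finset.univ.val.map f = ∑ a, {f a} := by
  rw [Finset.sum, ← Multiset.sum_map_singleton (Multiset.map f _), Multiset.map_map]
  rfl

/-- The parts of a partition in increasing order. -/
def partsList {ℓ : ℕ} (p : ℓ.Partition) : List ℕ := p.parts.sort (· ≤ ·)

theorem coe_partsList {ℓ : ℕ} (p : ℓ.Partition) : (partsList p : Multiset ℕ) = p.parts :=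
  Multiset.sort_eq _ _

theorem mem_partsList {ℓ : ℕ} {p : ℓ.Partition} {r : ℕ} : r ∈ partsList p ↔ r ∈ p.parts :=
  Multiset.mem_sort _

theorem sum_partsList {ℓ : ℕ} (p : ℓ.Partition) : (partsList p).sum = ℓ := by
  rw [← Multiset.sum_coe, coe_partsList, p.parts_sum]

/-- The pairs of a part `r` and a natural number less than `r`. -/
abbrev PartIndex {ℓ : ℕ} (p : ℓ.Partition) : Type :=
  Σ i : Fin (partsList p).length, Fin ((partsList p).get i)

/-- The number `(2a - 1)m / (4r)` for a pair of a part `r` and `a - 1 < r`. -/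
def expo {ℓ : ℕ} {p : ℓ.Partition} (x : PartIndex p) : ℕ :=
  (2 * (x.2 : ℕ) + 1) * (bigM p / (4 * (partsList p).get x.1))

theorem coe_sigmaList {ℓ : ℕ} (p : ℓ.Partition) :
    (sigmaList p : Multiset ℕ) = Finset.univ.val.map (expo : PartIndex p → ℕ) := by
  have hdvd : ∀ r ∈ p.parts, 4 * r ∣ bigM p := fun r hr =>
    mul_dvd_mul_left 4 (Multiset.dvd_lcm hr)
  rw [sigmaList, Multiset.sort_eq, map_univ_eq_finset_sum, Fintype.sum_sigma]
  conv_lhs => rw [← coe_partsList p]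
  rw [Multiset.bind, Multiset.join, Multiset.map_coe, Multiset.sum_coe, ← Fin.sum_univ_fun_getElem]
  refine Finset.sum_congr rfl fun i _ => ?_
  have hi := mem_partsList.1 (List.get_mem (partsList p) i)
  simp only [expo]
  rw [← List.get_eq_getElem]
  generalize (partsList p).get i = r at hi
  rw [Fin.sum_univ_eq_sum_range
    (fun a => ({(2 * a + 1) * (bigM p / (4 * r))} : Multiset ℕ)) r,
    ← Multiset.sum_map_singleton (Multiset.map _ _), Multiset.map_map]
  change ∑ a ∈ Finset.Icc 1 r, ({(2 * a - 1) * bigM p / (4 * r)} : Multiset ℕ) = _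
  rw [← Finset.Ico_add_one_right_eq_Icc, Finset.sum_Ico_eq_sum_range]
  refine Finset.sum_congr rfl fun a _ => ?_
  -- Since `4r` divides `m`, the natural number division is exact and the odd factor comes out.
  rw [Nat.mul_div_assoc _ (hdvd r hi)]
  congr 2
  omega

theorem length_sigmaList {ℓ : ℕ} (p : ℓ.Partition) : (sigmaList p).length = ℓ := by
  rw [← Multiset.coe_card, coe_sigmaList]
  simp only [Multiset.card_map, Finset.card_val, Finset.card_univ, Fintype.card_sigma,
    Fintype.card_fin]
  exact (Fin.sum_univ_getElem (partsList p)).trans (sum_partsList p)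

theorem ofFn_sigmaFun {ℓ : ℕ} (p : ℓ.Partition) : List.ofFn (sigmaFun p) = sigmaList p := by
  refine List.ext_getElem (by simp [length_sigmaList]) fun i h₁ h₂ => ?_
  simp [sigmaFun, h₂]

theorem map_univ_sigmaFun {ℓ : ℕ} (p : ℓ.Partition) :
    Finset.univ.val.map (sigmaFun p) = (sigmaList p : Multiset ℕ) := by
  rw [← ofFn_sigmaFun, Fin.univ_val_map]

/-- A parametrization of the numbers `σ_k` by pairs of a part `r` and `a < r`. -/
theorem exists_equiv_sigmaFun {ℓ : ℕ} (p : ℓ.Partition) :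
    ∃ e : Fin ℓ ≃ PartIndex p, ∀ k, expo (e k) = sigmaFun p k :=
  exists_equiv_of_map_univ_eq (sigmaFun p) expo ((map_univ_sigmaFun p).trans (coe_sigmaList p))

theorem bigM_pos {ℓ : ℕ} (p : ℓ.Partition) : 0 < bigM p := by
  refine Nat.mul_pos (by norm_num) (Nat.pos_of_ne_zero ?_)
  rw [Ne, Multiset.lcm_eq_zero_iff]
  exact fun h => (p.parts_pos h).ne rfl

theorem exists_bigM_eq {ℓ : ℕ} (p : ℓ.Partition) (i : Fin (partsList p).length) :
    0 < (partsList p).get i ∧ ∃ q, 0 < q ∧ bigM p = 4 * (partsList p).get i * q ∧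
      bigM p / (4 * (partsList p).get i) = q := by
  have hi := mem_partsList.1 (List.get_mem (partsList p) i)
  generalize (partsList p).get i = r at hi
  have hr0 := p.parts_pos hi
  obtain ⟨q, hq⟩ : 4 * r ∣ bigM p := mul_dvd_mul_left 4 (Multiset.dvd_lcm hi)
  refine ⟨hr0, q, Nat.pos_of_ne_zero ?_, hq, by rw [hq, Nat.mul_div_cancel_left _ (by omega)]⟩
  rintro rfl
  exact (bigM_pos p).ne' hq

/-! ### The diagonal form of `n` -/

theorem pow_half_eq_neg_one {η : ℂˣ} {m : ℕ} (hη : IsPrimitiveRoot η (2 * m))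
    (hm : 0 < m) : η ^ m = -1 := by
  have h1 : η ^ m ≠ 1 := hη.pow_ne_one_of_pos_of_lt hm.ne' (by omega)
  have h2 : (η : ℂ) ^ m * (η : ℂ) ^ m = 1 := by
    rw [← pow_add, ← two_mul, ← Units.val_pow_eq_pow_val, hη.pow_eq_one, Units.val_one]
  rcases mul_self_eq_one_iff.1 h2 with h | h
  · exact absurd (Units.ext (by simpa using h)) h1
  · exact Units.ext (by simpa using h)

/-- Write `m = 4rq`. The exponents of a part `r` are the odd multiples of `q` below `2rq = m/2`.
Their `2r`-th powers are odd powers of `η ^ (m/2) = -1`; two exponents sum to less than `m`, so no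
two eigenvalues are inverse, and distinct exponents give distinct eigenvalues. -/
theorem isConj_torusElt_pow_sigmaFun {ℓ : ℕ} {p : ℓ.Partition} {n : ↥(normTorus ℓ)}
    (hn : ConjClasses.mk (toWeyl n) = ellipticClass p) {η : ℂˣ}
    (hη : IsPrimitiveRoot η (bigM p)) :
    IsConj (n : Sp ℓ) (torusElt fun k => η ^ sigmaFun p k) := by
  obtain ⟨a, ha, hconj⟩ := exists_isConj_nElt_mul hn
  refine hconj.trans ?_
  obtain ⟨e, he⟩ := exists_equiv_sigmaFun p
  have hsum := sum_partsList p
  have hmem := exists_bigM_eq p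
  have hcyc : ∀ i : Fin (partsList p).length, IsNegCycle (nElt p * a)
      ((partsList p).take i).sum ((partsList p).get i) := by
    intro i
    have hL : (partsList p).take i ++ (partsList p).get i :: (partsList p).drop (i + 1) =
      partsList p := by simp
    have := isNegCycle_partsElt (ℓ := ℓ) (r := (partsList p).get i)
      ((partsList p).take i) ((partsList p).drop (i + 1)) 0
      (by rw [hL]; exact fun r hr => p.parts_pos (mem_partsList.1 hr)) (by rw [hL]; omega)
    rw [hL, zero_add] at this
    exact this.mul_torus ha
  have htake : ∀ (i : Fin (partsList p).length) (j : ℕ), (i : ℕ) < j →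
      ((partsList p).take i).sum + (partsList p).get i ≤ ((partsList p).take j).sum := by
    intro i j hij
    rw [List.get_eq_getElem, ← List.sum_take_succ _ _ i.2]
    exact List.monotone_sum_take _ hij
  have hle : ∀ i : Fin (partsList p).length,
      ((partsList p).take i).sum + (partsList p).get i ≤ ℓ := by
    intro i
    have := htake i (partsList p).length i.2
    rwa [List.take_length, hsum] at this
  have hpos : ∀ i, 0 < (partsList p).get i := fun i => (hmem i).1
  refine isConj_torusElt_of_negOrbits (partsList p).get
    (fun i => vec ℓ (false, ((partsList p).take i).sum)) hpos
    (fun i => (hcyc i).isNegOrbit (hpos i) (hle i)) ?_ (fun k => (e k).1) _ ?_ ?_ ?_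
  · intro i i' hne j hj
    refine (hcyc i').form_eq_zero ?_ hj
    rcases lt_or_gt_of_ne hne with h | h
    · have := htake i i' h
      have := hpos i
      omega
    · exact .inr (htake i' i h)
  · intro k
    rw [← he]
    rcases e k with ⟨i, a⟩
    obtain ⟨hr, q, hq, hm, hmq⟩ := hmem i
    simp only [expo, hmq]
    have hm2 : bigM p = 2 * (2 * (partsList p).get i * q) := by rw [hm]; ring
    rw [← pow_mul, show (2 * (a : ℕ) + 1) * q * (2 * (partsList p).get i) =
      (2 * (partsList p).get i * q) * (2 * a + 1) by ring, pow_mul,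
      pow_half_eq_neg_one (η := η) (by rwa [← hm2]) (by positivity)]
    exact Odd.neg_one_pow ⟨_, rfl⟩
  · intro k k'
    rw [← he, ← he]
    rcases e k with ⟨i, a⟩
    rcases e k' with ⟨i', a'⟩
    rintro rfl
    obtain ⟨hr, q, hq, hm, hmq⟩ := hmem i
    simp only [expo, hmq]
    rw [← pow_add, ← add_mul]
    refine hη.pow_ne_one_of_pos_of_lt (by positivity) ?_
    rw [hm]
    exact Nat.mul_lt_mul_of_pos_right (by omega) hq
  · intro k k' hkk' hne heq
    rw [← he, ← he] at heq
    refine hne (e.injective ?_)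
    revert hkk' heq
    rcases e k with ⟨i, a⟩
    rcases e k' with ⟨i', a'⟩
    rintro rfl heq
    obtain ⟨hr, q, hq, hm, hmq⟩ := hmem i
    simp only [expo, hmq] at heq
    have := hη.pow_inj (by rw [hm]; exact Nat.mul_lt_mul_of_pos_right (by omega) hq)
      (by rw [hm]; exact Nat.mul_lt_mul_of_pos_right (by omega) hq) heq
    have := Nat.eq_of_mul_eq_mul_right hq this
    congr 1
    ext
    omega

/-! ### The exponential function -/

/-- The function `e^{2πix}`. -/
def expUnit (x : ℝ) : ℂˣ := Units.mk0 (Complex.exp (2 * Real.pi * Complex.I * (x : ℂ)))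
  (Complex.exp_ne_zero _)

theorem expUnit_eq_one_iff {x : ℝ} : expUnit x = 1 ↔ ∃ k : ℤ, x = k := by
  rw [← Units.val_inj, expUnit, Units.val_mk0, Units.val_one, Complex.exp_eq_one_iff]
  refine exists_congr fun k => ?_
  rw [mul_comm, mul_left_inj' Complex.two_pi_I_ne_zero]
  exact_mod_cast Iff.rfl

theorem expUnit_pow (x : ℝ) (k : ℕ) : expUnit x ^ k = expUnit (k * x) := by
  ext
  rw [Units.val_pow_eq_pow_val, expUnit, expUnit, Units.val_mk0, Units.val_mk0, ← Complex.exp_nat_mul]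
  congr 1
  push_cast
  ring

theorem isPrimitiveRoot_expUnit {k : ℤ} {m : ℕ} (hm : 0 < m) (hk : IsCoprime k (m : ℤ)) :
    IsPrimitiveRoot (expUnit (k / m)) m := by
  have hm0 : (m : ℝ) ≠ 0 := by positivity
  refine ⟨?_, fun j hj => ?_⟩
  · rw [expUnit_pow, expUnit_eq_one_iff]
    exact ⟨k, by field_simp⟩
  · rw [expUnit_pow, expUnit_eq_one_iff] at hj
    obtain ⟨i, hi⟩ := hj
    field_simp at hi
    have hi' : (j : ℤ) * k = m * i := by exact_mod_cast hi
    exact_mod_cast hk.symm.dvd_of_dvd_mul_right ⟨i, hi'⟩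

/-! ### Torus elements -/

theorem torusElt_injective {ℓ : ℕ} : Function.Injective (torusElt : (Fin ℓ → ℂˣ) → Sp ℓ) := by
  intro a b h
  have := congrArg (fun g : Sp ℓ => g.1) h
  simp only [coe_torusElt, Matrix.diagonal_injective.eq_iff] at this
  ext k
  exact congrFun this (.inl k)

theorem torusElt_mul {ℓ : ℕ} (a b : Fin ℓ → ℂˣ) : torusElt (a * b) = torusElt a * torusElt b := by
  ext1
  rw [Submonoid.coe_mul, coe_torusElt, coe_torusElt, coe_torusElt, Matrix.diagonal_mul_diagonal]
  congr 1
  ext (k | k) <;> simp [mul_comm]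

theorem torusElt_one {ℓ : ℕ} : torusElt (1 : Fin ℓ → ℂˣ) = 1 := by
  have := torusElt_mul (1 : Fin ℓ → ℂˣ) 1
  rwa [mul_one, left_eq_mul] at this

theorem torusElt_pow {ℓ : ℕ} (a : Fin ℓ → ℂˣ) (k : ℕ) : torusElt (a ^ k) = torusElt a ^ k := by
  induction k with
  | zero => rw [pow_zero, pow_zero, torusElt_one]
  | succ k ih => rw [pow_succ, pow_succ, torusElt_mul, ih]

/-- The eigenvalues of a torus element, with multiplicities. -/
def eigenvalues {ℓ : ℕ} (a : Fin ℓ → ℂˣ) : Multiset ℂˣ :=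
  Finset.univ.val.map a + Finset.univ.val.map a⁻¹

theorem roots_charpoly_torusElt {ℓ : ℕ} (a : Fin ℓ → ℂˣ) :
    (torusElt a).1.charpoly.roots = (eigenvalues a).map (fun u : ℂˣ => (u : ℂ)) := by
  have key (f : Fin ℓ → ℂ) : (∏ k, (Polynomial.X - Polynomial.C (f k))).roots =
      Finset.univ.val.map f := by
    have := Polynomial.roots_multiset_prod_X_sub_C (Finset.univ.val.map f)
    rwa [Multiset.map_map] at this
  rw [coe_torusElt, Matrix.charpoly_diagonal, Fintype.prod_sum_type, Polynomial.roots_mul, eigenvalues,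
    Multiset.map_add, Multiset.map_map, Multiset.map_map]
  · simp only [Sum.elim_inl, Sum.elim_inr, key]
    rfl
  · exact mul_ne_zero (Finset.prod_ne_zero_iff.2 fun k _ => Polynomial.X_sub_C_ne_zero _)
      (Finset.prod_ne_zero_iff.2 fun k _ => Polynomial.X_sub_C_ne_zero _)

theorem eigenvalues_eq_of_isConj {ℓ : ℕ} {a b : Fin ℓ → ℂˣ} (h : IsConj (torusElt a) (torusElt b)) :
    eigenvalues a = eigenvalues b := by
  obtain ⟨c, hc⟩ := isConj_iff.1 h
  have h1 : c.1 * (c⁻¹).1 = 1 := by rw [← Submonoid.coe_mul, mul_inv_cancel, Submonoid.coe_one]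
  have h2 : (c⁻¹).1 * c.1 = 1 := by rw [← Submonoid.coe_mul, inv_mul_cancel, Submonoid.coe_one]
  have hchar : (torusElt b).1.charpoly = (torusElt a).1.charpoly := by
    rw [← hc, Submonoid.coe_mul, Submonoid.coe_mul]
    generalize (torusElt a).1 = A
    generalize c.1 = C at *
    generalize (c⁻¹).1 = D at *
    have := Matrix.charpoly_units_conj ⟨C, D, h1, h2⟩ A
    rwa [Matrix.inv_eq_right_inv h1] at this
  refine Multiset.map_injective (f := fun u : ℂˣ => (u : ℂ)) (fun _ _ => Units.ext) ?_
  rw [← roots_charpoly_torusElt, ← roots_charpoly_torusElt, hchar]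

/-! ### The center -/

theorem apply_eq_of_commute {ι : Type*} [Fintype ι] [DecidableEq ι] {d : ι → ℂ}
    {A : Matrix ι ι ℂ} (h : Matrix.diagonal d * A = A * Matrix.diagonal d) {i j : ι}
    (hA : A i j ≠ 0) : d i = d j := by
  have := congrFun₂ h i j
  rw [Matrix.diagonal_mul, Matrix.mul_diagonal, mul_comm] at this
  exact mul_left_cancel₀ hA this

theorem exists_eq_torusElt_of_mem_center {ℓ : ℕ} (hℓ : 0 < ℓ) {z : Sp ℓ}
    (hz : z ∈ Subgroup.center (Sp ℓ)) :
    ∃ ε : ℂˣ, (ε = 1 ∨ ε = -1) ∧ z = torusElt fun _ => ε := by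
  have hcomm (g : Sp ℓ) : z.1 * g.1 = g.1 * z.1 :=
    congrArg (fun g : Sp ℓ => g.1) (Subgroup.mem_center_iff.1 hz g).symm
  obtain ⟨d, hd⟩ : ∃ d, z.1 = Matrix.diagonal d := by
    -- Distinct integers `N i`, opposite on paired indices, give a torus element with distinct
    -- entries `2 ^ N i`; a matrix commuting with it is diagonal.
    set N : Fin ℓ ⊕ Fin ℓ → ℤ := Sum.elim (fun k => (k : ℤ) + 1) (fun k => -((k : ℤ) + 1)) with hN
    have hNinj : Function.Injective N := by
      rintro (i | i) (j | j) h <;> simp only [hN, Sum.elim_inl, Sum.elim_inr] at h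
      · rw [Fin.ext (show (i : ℕ) = j by omega)]
      · omega
      · omega
      · rw [Fin.ext (show (i : ℕ) = j by omega)]
    have h := hcomm (torusElt fun k => (Units.mk0 (2 : ℂ) two_ne_zero) ^ ((k : ℤ) + 1))
    have hD : (torusElt fun k : Fin ℓ => (Units.mk0 (2 : ℂ) two_ne_zero) ^ ((k : ℤ) + 1)).1 =
        Matrix.diagonal fun i => (((2 : ℝ) ^ N i : ℝ) : ℂ) := by
      rw [coe_torusElt]
      congr 1
      ext (k | k) <;> simp only [hN, Sum.elim_inl, Sum.elim_inr, zpow_neg] <;> push_cast <;> simp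
    rw [hD] at h
    refine ⟨fun i => z.1 i i, ?_⟩
    ext i j
    rw [Matrix.diagonal_apply]
    split_ifs with hij
    · rw [hij]
    · by_contra h0
      have := apply_eq_of_commute h.symm h0
      exact hij (hNinj (zpow_right_injective₀ two_pos (by norm_num) (Complex.ofReal_injective this)))
  have hd' {g : Sp ℓ} {i j} (hg : g.1 i j ≠ 0) : d i = d j :=
    apply_eq_of_commute (hd ▸ hcomm g) hg
  -- Transpositions link the entries within a half and `Matrix.J` links the two halves, so `z` is
  -- scalar; the symplectic condition then gives `c * c = 1`.
  have hl (i j : Fin ℓ) : d (.inl i) = d (.inl j) :=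
    hd' (g := permElt (Equiv.swap i j)) (by simp [permElt, PEquiv.toMatrix_apply])
  have hr (i : Fin ℓ) : d (.inl i) = d (.inr i) :=
    hd' (g := SymplecticGroup.symJ _ _) (by simp [Matrix.J])
  set c := d (.inl ⟨0, hℓ⟩)
  have hc : d = fun _ => c := by
    ext (i | i)
    · exact hl _ _
    · rw [← hr]; exact hl _ _
  have hcc : c * c = 1 := by
    have := congrFun₂ (SymplecticGroup.mem_iff.1 z.2) (.inr ⟨0, hℓ⟩) (.inl ⟨0, hℓ⟩)
    simpa [hd, hc, Matrix.J, Matrix.diagonal_mul, Matrix.mul_diagonal] using this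
  refine ⟨Units.mk0 c (left_ne_zero_of_mul_eq_one hcc), ?_, ?_⟩
  · rcases mul_self_eq_one_iff.1 hcc with h | h
    · exact .inl (Units.ext h)
    · exact .inr (Units.ext h)
  · ext1
    rw [hd, coe_torusElt, hc]
    congr 1
    ext (k | k)
    · rfl
    · simpa using eq_inv_of_mul_eq_one_left hcc

/-! ### Exponents -/

theorem expo_lt {ℓ : ℕ} {p : ℓ.Partition} (x : PartIndex p) : 2 * expo x < bigM p := by
  obtain ⟨i, a⟩ := x
  obtain ⟨hr, q, hq, hm, hmq⟩ := exists_bigM_eq p i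
  simp only [expo, hmq]
  rw [hm, ← mul_assoc]
  exact Nat.mul_lt_mul_of_pos_right (by omega) hq

theorem two_mul_sigmaFun_lt {ℓ : ℕ} (p : ℓ.Partition) (k : Fin ℓ) :
    2 * sigmaFun p k < bigM p := by
  obtain ⟨e, he⟩ := exists_equiv_sigmaFun p
  exact he k ▸ expo_lt _

/-- Reversing `a` within each part pairs the odd factors to the sum `2r`, so the exponents pair to
`2rq = m/2`. -/
theorem exists_perm_sigmaFun {ℓ : ℕ} (p : ℓ.Partition) :
    ∃ τ : Equiv.Perm (Fin ℓ), ∀ k, 2 * (sigmaFun p k + sigmaFun p (τ k)) = bigM p := by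
  obtain ⟨e, he⟩ := exists_equiv_sigmaFun p
  refine ⟨(e.trans (Equiv.sigmaCongrRight fun _ => Fin.revPerm)).trans e.symm, fun k => ?_⟩
  rw [← he, ← he]
  simp only [Equiv.trans_apply, Equiv.apply_symm_apply]
  rcases e k with ⟨i, a⟩
  obtain ⟨hr, q, hq, hm, hmq⟩ := exists_bigM_eq p i
  change 2 * ((2 * (a : ℕ) + 1) * _ + (2 * (Fin.rev a : ℕ) + 1) *
    (bigM p / (4 * (partsList p).get i))) = _
  rw [Fin.val_rev, hmq, hm, ← add_mul, ← mul_assoc]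
  congr 1
  omega

theorem antitone_sigmaFun {ℓ : ℕ} (p : ℓ.Partition) : Antitone (sigmaFun p) := by
  have h := (Multiset.pairwise_sort (p.parts.bind fun r => (Finset.Icc 1 r).val.map fun a =>
    (2 * a - 1) * bigM p / (4 * r)) (· ≥ ·))
  change (sigmaList p).Pairwise (· ≥ ·) at h
  rw [← ofFn_sigmaFun, List.pairwise_ofFn] at h
  intro i j hij
  rcases hij.eq_or_lt with rfl | hij
  · rfl
  · exact h hij

theorem eq_of_map_univ_eq {ℓ : ℕ} {u w : Fin ℓ → ℕ} (hu : Antitone u) (hw : Antitone w)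
    (h : Finset.univ.val.map u = Finset.univ.val.map w) : u = w := by
  rw [Fin.univ_val_map, Fin.univ_val_map, Multiset.coe_eq_coe] at h
  refine List.ofFn_injective (h.eq_of_pairwise' (r := (· ≥ ·)) ?_ ?_) <;> rw [List.pairwise_ofFn]
  · exact fun i j hij => hu hij.le
  · exact fun i j hij => hw hij.le

/-! ### The order and the spectrum of `n` -/

theorem orderOf_eq_of_isConj {G : Type*} [Group G] {a b : G} (h : IsConj a b) :
    orderOf a = orderOf b := by
  obtain ⟨c, rfl⟩ := isConj_iff.1 h
  exact ((MulAut.conj c).orderOf_eq a).symm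

theorem orderOf_eq_bigM {ℓ : ℕ} (hℓ : 0 < ℓ) {p : ℓ.Partition} {n : ↥(normTorus ℓ)}
    (hn : ConjClasses.mk (toWeyl n) = ellipticClass p) : orderOf (n : Sp ℓ) = bigM p := by
  have hη := isPrimitiveRoot_expUnit (bigM_pos p) isCoprime_one_left
  rw [orderOf_eq_of_isConj (isConj_torusElt_pow_sigmaFun hn hη)]
  set η := expUnit _
  have hpow (k : ℕ) : torusElt (fun j => η ^ sigmaFun p j) ^ k = 1 ↔
      ∀ j, bigM p ∣ sigmaFun p j * k := by
    rw [← torusElt_pow, ← torusElt_one, torusElt_injective.eq_iff, funext_iff]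
    simp only [Pi.pow_apply, Pi.one_apply, ← pow_mul, hη.pow_eq_one_iff_dvd]
  refine Nat.dvd_antisymm (orderOf_dvd_of_pow_eq_one ((hpow _).2 fun j => dvd_mul_left _ _)) ?_
  have h := (hpow _).1 (pow_orderOf_eq_one _)
  generalize orderOf (torusElt fun j => η ^ sigmaFun p j) = k at h ⊢
  obtain ⟨e, he⟩ := exists_equiv_sigmaFun p
  have hdvd : ∀ r ∈ p.parts, 4 * r ∣ k := by
    intro r hr
    obtain ⟨i, rfl⟩ := List.get_of_mem (mem_partsList.2 hr)
    obtain ⟨hr, q, hq, hm, hmq⟩ := exists_bigM_eq p i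
    -- The smallest exponent `q = m / (4r)` of the part `r` forces `4r ∣ k`.
    have := h (e.symm ⟨i, ⟨0, hr⟩⟩)
    rw [← he, Equiv.apply_symm_apply, expo, hmq, hm, mul_zero, zero_add, one_mul, mul_comm q] at this
    exact Nat.dvd_of_mul_dvd_mul_right hq this
  obtain ⟨k', rfl⟩ : 4 ∣ k := by
    obtain ⟨r, hr⟩ : ∃ r, r ∈ p.parts := by
      refine Multiset.exists_mem_of_ne_zero fun h0 => hℓ.ne' ?_
      rw [← p.parts_sum, h0, Multiset.sum_zero]
    exact (dvd_mul_right _ _).trans (hdvd r hr)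
  exact Nat.mul_dvd_mul_left 4 (Multiset.lcm_dvd.2 fun r hr =>
    Nat.dvd_of_mul_dvd_mul_left (by norm_num) (hdvd r hr))

/-- As `η ^ (m/2) = -1`, negating an eigenvalue gives the inverse of the one with the complementary
exponent. -/
theorem eigenvalues_neg {ℓ : ℕ} {p : ℓ.Partition} {η : ℂˣ} (hη : IsPrimitiveRoot η (bigM p)) :
    eigenvalues (fun k => -η ^ sigmaFun p k) = eigenvalues (fun k => η ^ sigmaFun p k) := by
  obtain ⟨τ, hτ⟩ := exists_perm_sigmaFun p
  have h2 : bigM p = 2 * (2 * p.parts.lcm) := by rw [bigM]; ring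
  have hhalf : η ^ (2 * p.parts.lcm) = -1 :=
    pow_half_eq_neg_one (by rwa [← h2]) (by have := bigM_pos p; omega)
  have key : (fun k => -η ^ sigmaFun p k) = (fun k => η ^ sigmaFun p k)⁻¹ ∘ τ := by
    ext1 k
    have : sigmaFun p k + sigmaFun p (τ k) = 2 * p.parts.lcm := by have := hτ k; omega
    rw [Function.comp_apply, Pi.inv_apply, eq_inv_iff_mul_eq_one, neg_mul, ← pow_add, this, hhalf,
      neg_neg]
  have hcomp (f : Fin ℓ → ℂˣ) : Finset.univ.val.map (f ∘ τ) = Finset.univ.val.map f := by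
    rw [← Multiset.map_map, Multiset.map_univ_val_equiv]
  have hinv : ((fun k => η ^ sigmaFun p k)⁻¹ ∘ τ)⁻¹ = (fun k => η ^ sigmaFun p k) ∘ τ := by
    ext1 k; simp
  rw [key, eigenvalues, hinv, hcomp, hcomp, add_comm]
  rfl

theorem map_univ_eq_of_eigenvalues_eq {ℓ m : ℕ} {η : ℂˣ} (hη : IsPrimitiveRoot η m) (hm : 0 < m)
    {u w : Fin ℓ → ℕ} (hu : ∀ k, 2 * u k ≤ m) (hw : ∀ k, 2 * w k ≤ m)
    (h : eigenvalues (fun k => η ^ u k) = eigenvalues (fun k => η ^ w k)) :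
    Finset.univ.val.map u = Finset.univ.val.map w := by
  -- `f` recovers an exponent `d ≤ m/2` from `η ^ d` or its inverse, so the spectrum yields every
  -- exponent exactly twice.
  set f : ℂˣ → ℕ := fun z => sInf {d : ℕ | η ^ d = z ∨ η ^ d * z = 1}
  have hf' (z : ℂˣ) (d : ℕ) (hd : 2 * d ≤ m) (hz : z = η ^ d ∨ z = (η ^ d)⁻¹) : f z = d := by
    refine le_antisymm (Nat.sInf_le ?_) (le_csInf ⟨d, ?_⟩ fun c hc => ?_)
    · rcases hz with rfl | rfl <;> simp
    · rcases hz with rfl | rfl <;> simp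
    · by_contra! hcd
      have h1 : η ^ c ≠ η ^ d := fun h => hcd.ne (hη.pow_inj (by omega) (by omega) h)
      have h2 : η ^ c * η ^ d ≠ 1 := by
        rw [← pow_add]
        exact hη.pow_ne_one_of_pos_of_lt (by omega) (by omega)
      rcases hz with rfl | rfl <;> rcases hc with hc | hc
      · exact h1 hc
      · exact h2 hc
      · exact h2 (by rw [hc, inv_mul_cancel])
      · exact h1 (mul_inv_eq_one.1 hc)
  have hmap (u : Fin ℓ → ℕ) (hu : ∀ k, 2 * u k ≤ m) :
      (eigenvalues (fun k => η ^ u k)).map f =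
        Finset.univ.val.map u + Finset.univ.val.map u := by
    rw [eigenvalues, Multiset.map_add, Multiset.map_map, Multiset.map_map]
    congr 1 <;> refine Multiset.map_congr rfl fun k _ => hf' _ _ (hu k) (by simp)
  have := congrArg (Multiset.map f) h
  rw [hmap u hu, hmap w hw] at this
  ext c
  have := congrArg (Multiset.count c) this
  rw [Multiset.count_add, Multiset.count_add] at this
  omega

/-! ### The alcove -/

/-- The coordinates of `v`, continued by zero. -/
def coordNat {ℓ : ℕ} (v : Fin ℓ → ℝ) (k : ℕ) : ℝ := if h : k < ℓ then v ⟨k, h⟩ else 0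

theorem coordNat_coe {ℓ : ℕ} (v : Fin ℓ → ℝ) (k : Fin ℓ) : coordNat v k = v k := by
  simp [coordNat]

/-- Continuation by zero gives the long root the same form as the short ones, so the highest root
telescopes to twice the first coordinate. -/
theorem nodeCoeff_mul_simpleRoot {ℓ : ℕ} (k : Fin ℓ) (v : Fin ℓ → ℝ) :
    (nodeCoeff k.succ : ℝ) * simpleRoot k v = 2 * (coordNat v k - coordNat v (k + 1)) := by
  by_cases h : (k : ℕ) + 1 < ℓ
  · have h' : (k : ℕ) + 1 ≠ ℓ := by omega
    simp [nodeCoeff, simpleRoot, coordNat, h, h']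
  · have h' : (k : ℕ) + 1 = ℓ := by omega
    simp [nodeCoeff, simpleRoot, coordNat, h']

theorem highestRoot_eq {ℓ : ℕ} (v : Fin ℓ → ℝ) : highestRoot v = 2 * coordNat v 0 := by
  rw [highestRoot, Finset.sum_congr rfl fun k _ => nodeCoeff_mul_simpleRoot k v,
    Fin.sum_univ_eq_sum_range (fun k => 2 * (coordNat v k - coordNat v (k + 1))) ℓ,
    ← Finset.mul_sum, Finset.sum_range_sub']
  simp [coordNat]

theorem simpleRoot_smul {ℓ : ℕ} (k : Fin ℓ) (c : ℝ) (v : Fin ℓ → ℝ) :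
    simpleRoot k (c • v) = c * simpleRoot k v := by
  rw [simpleRoot, simpleRoot]
  split_ifs <;> simp only [Pi.smul_apply, smul_eq_mul] <;> ring

theorem simpleRoot_sum {ℓ : ℕ} {ι : Type*} [Fintype ι] (k : Fin ℓ) (f : ι → Fin ℓ → ℝ) :
    simpleRoot k (∑ i, f i) = ∑ i, simpleRoot k (f i) := by
  simp only [simpleRoot]
  split_ifs
  · simp [Finset.sum_apply]
  · simp [Finset.sum_apply, Finset.mul_sum]

theorem simpleRoot_coweight {ℓ : ℕ} (k j : Fin ℓ) :
    simpleRoot k (coweight j) = if j = k then 1 else 0 := by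
  simp only [simpleRoot, coweight, Fin.le_def, Fin.ext_iff]
  split_ifs <;> first | omega | norm_num

theorem simpleRoot_sum_coweight {ℓ : ℕ} (k : Fin ℓ) (s : Fin ℓ → ℝ) :
    simpleRoot k (∑ j, s j • coweight j) = s k := by
  rw [simpleRoot_sum]
  simp [simpleRoot_smul, simpleRoot_coweight]

theorem ext_simpleRoot {ℓ : ℕ} {v w : Fin ℓ → ℝ} (h : ∀ k, simpleRoot k v = simpleRoot k w) :
    v = w := by
  have key : ∀ (j : ℕ) (k : Fin ℓ), (k : ℕ) + j + 1 = ℓ → v k = w k := by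
    intro j
    induction j with
    | zero =>
      intro k hk
      have hk' : ¬ (k : ℕ) + 1 < ℓ := by omega
      simpa [simpleRoot, hk'] using h k
    | succ j ih =>
      intro k hk
      have hk' : (k : ℕ) + 1 < ℓ := by omega
      have := ih ⟨k + 1, hk'⟩ (by simp only; omega)
      simpa [simpleRoot, hk', this] using h k
  ext k
  exact key (ℓ - 1 - k) k (by omega)

theorem simpleRoot_nonneg_iff {ℓ : ℕ} {v : Fin ℓ → ℝ} :
    (∀ k, 0 ≤ simpleRoot k v) ↔ Antitone (coordNat v) := by
  have key (k : Fin ℓ) : 0 ≤ simpleRoot k v ↔ coordNat v (k + 1) ≤ coordNat v k := by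
    have hpos : (0 : ℝ) < nodeCoeff k.succ := by
      rw [nodeCoeff]; split_ifs <;> norm_num
    rw [← mul_nonneg_iff_of_pos_left hpos, nodeCoeff_mul_simpleRoot,
      mul_nonneg_iff_of_pos_left two_pos, sub_nonneg]
  refine ⟨fun h => antitone_nat_of_succ_le fun k => ?_, fun h k => (key k).2 (h k.1.le_succ)⟩
  rcases lt_or_ge k ℓ with hk | hk
  · exact (key ⟨k, hk⟩).1 (h _)
  · have h1 : ¬ k < ℓ := by omega
    have h2 : ¬ k + 1 < ℓ := by omega
    simp [coordNat, h1, h2]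

theorem antitone_of_mem_closedAlcove {ℓ : ℕ} {v : Fin ℓ → ℝ} (h : v ∈ closedAlcove ℓ) :
    Antitone v ∧ ∀ k, 0 ≤ v k ∧ 2 * v k ≤ 1 := by
  have ha := simpleRoot_nonneg_iff.1 h.1
  refine ⟨fun i j hij => ?_, fun k => ⟨?_, ?_⟩⟩
  · rw [← coordNat_coe v, ← coordNat_coe v]
    exact ha hij
  · rw [← coordNat_coe v]
    exact le_trans (by simp [coordNat]) (ha k.2.le)
  · rw [← coordNat_coe v]
    have := h.2
    rw [highestRoot_eq] at this
    linarith [ha (Nat.zero_le k)]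

/-- This turns the condition `M = ∑ b_k s_k` into the value of the label at `γ_0`. -/
theorem coordNat_zero_eq {ℓ : ℕ} (s : Fin (ℓ + 1) → ℤ) {v : Fin ℓ → ℝ}
    (hs : ∀ k, simpleRoot k v = s (Fin.succ k)) :
    ((∑ i, nodeCoeff i * s i : ℤ) : ℝ) = s 0 + 2 * coordNat v 0 := by
  rw [Fin.sum_univ_succ, ← highestRoot_eq, highestRoot]
  push_cast
  simp [hs, nodeCoeff]

/-! ### The labels -/

theorem labels_zero {ℓ : ℕ} (hℓ : 0 < ℓ) (p : ℓ.Partition) :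
    labels p 0 = bigM p - 2 * sigmaFun p ⟨0, hℓ⟩ := rfl

theorem labels_succ {ℓ : ℕ} (p : ℓ.Partition) (k : Fin ℓ) :
    (labels p k.succ : ℝ) = simpleRoot k fun j => (sigmaFun p j : ℝ) := by
  rw [labels, simpleRoot, Fin.val_succ, if_neg (Nat.succ_ne_zero _)]
  by_cases h : (k : ℕ) + 1 < ℓ
  · rw [if_neg h.ne, dif_pos h]
    simp [sigma, sigmaFun]
  · have h' : (k : ℕ) + 1 = ℓ := by omega
    rw [if_pos h', dif_neg h]
    have : ℓ - 1 = k := by omega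
    simp [sigma, sigmaFun, this]

theorem labels_nonneg {ℓ : ℕ} (hℓ : 0 < ℓ) (p : ℓ.Partition) (i : Fin (ℓ + 1)) :
    0 ≤ labels p i := by
  refine Fin.cases ?_ (fun k => ?_) i
  · rw [labels_zero hℓ]
    have := two_mul_sigmaFun_lt p ⟨0, hℓ⟩
    omega
  · have : (0 : ℝ) ≤ labels p k.succ := by
      rw [labels_succ, simpleRoot]
      split_ifs with h
      · exact sub_nonneg.2 (Nat.cast_le.2 (antitone_sigmaFun p (Nat.le_succ k)))
      · positivity
    exact_mod_cast this

theorem removeCommonFactors_mul {ι : Type*} [Fintype ι] {t : ℤ} (ht : 0 < t) (s : ι → ℤ) :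
    removeCommonFactors (fun i => t * s i) = removeCommonFactors s := by
  ext i
  rw [removeCommonFactors, removeCommonFactors, Finset.gcd_mul_left, Int.normalize_of_nonneg ht.le,
    Int.mul_ediv_mul_of_pos _ _ ht]

/-! ### Values of cocharacters -/

theorem expUnit_add (x y : ℝ) : expUnit (x + y) = expUnit x * expUnit y := by
  ext
  rw [Units.val_mul, expUnit, expUnit, expUnit, Units.val_mk0, Units.val_mk0, Units.val_mk0,
    ← Complex.exp_add]
  congr 1
  push_cast
  ring

theorem expUnit_eq_iff {x y : ℝ} : expUnit x = expUnit y ↔ ∃ k : ℤ, x - y = k := by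
  rw [← expUnit_eq_one_iff, ← mul_eq_right (b := expUnit y), ← expUnit_add, sub_add_cancel]

/-- Since `ξ ^ M = 1`, the principal logarithm of `ξ` is `2πik/M` for an integer `k`. Complex powers
are thereby made explicit. -/
theorem exists_cpow_eq_expUnit {ξ : ℂˣ} {M : ℕ} (hM : 0 < M) (hξ : IsPrimitiveRoot ξ M) :
    ∃ k : ℤ, IsCoprime k (M : ℤ) ∧
      ∀ x : ℝ, (ξ : ℂ) ^ (x : ℂ) = expUnit (k / M * x) := by
  have hM0 : (M : ℂ) ≠ 0 := by exact_mod_cast hM.ne'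
  have h1 : Complex.exp (M * Complex.log ξ) = 1 := by
    rw [Complex.exp_nat_mul, Complex.exp_log ξ.ne_zero, ← Units.val_pow_eq_pow_val, hξ.pow_eq_one,
      Units.val_one]
  obtain ⟨k, hk⟩ := Complex.exp_eq_one_iff.1 h1
  have hlog : Complex.log ξ = 2 * Real.pi * Complex.I * (k / M) := by
    field_simp
    linear_combination hk
  have hpow (x : ℝ) : (ξ : ℂ) ^ (x : ℂ) = expUnit (k / M * x) := by
    rw [Complex.cpow_def_of_ne_zero ξ.ne_zero, hlog, expUnit, Units.val_mk0]
    push_cast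
    ring_nf
  refine ⟨k, ?_, hpow⟩
  rw [Int.isCoprime_iff_gcd_eq_one]
  obtain ⟨c, hc⟩ : Int.gcd k M ∣ M := Int.natCast_dvd_natCast.1 (Int.gcd_dvd_right ..)
  obtain ⟨k', hk'⟩ : (Int.gcd k M : ℤ) ∣ k := Int.gcd_dvd_left ..
  have hξ' : ξ = expUnit (k / M) := by
    ext
    have := hpow 1
    simpa using this
  generalize Int.gcd k M = g at *
  have hg : 0 < g := Nat.pos_of_mul_pos_right (hc ▸ hM)
  have hc0 : 0 < c := Nat.pos_of_mul_pos_left (hc ▸ hM)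
  -- A common divisor `g` of `k` and `M = g c` would give `ξ ^ c = 1`, so primitivity forces `g =
  -- 1`.
  have : ξ ^ c = 1 := by
    rw [hξ', expUnit_pow, expUnit_eq_one_iff]
    refine ⟨k', ?_⟩
    rw [hc, hk']
    push_cast
    field_simp
  have := Nat.le_of_dvd hc0 (hξ.dvd_of_pow_eq_one _ this)
  rw [hc] at this
  nlinarith

theorem eigenvalues_neg_mul {ℓ : ℕ} (a : Fin ℓ → ℂˣ) :
    eigenvalues (fun k => -a k) = (eigenvalues a).map fun z => -z := by
  rw [eigenvalues, eigenvalues, Multiset.map_add, Multiset.map_map, Multiset.map_map]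
  congr 1

/-! ### Passing between `G` and the symplectic group -/

section

variable {ℓ : ℕ} {G : Type*} [Group G] {π : Sp ℓ →* G}

theorem isCocharacter_iff {v : Fin ℓ → ℝ} :
    IsCocharacter π v ↔ π (torusElt fun j => expUnit (v j)) = 1 := Iff.rfl

/-- Cocharacters thus have either all coordinates integral or all in `1/2 + ℤ`. -/
theorem IsCocharacter.exists_eq (hℓ : 0 < ℓ) (hker : π.ker ≤ Subgroup.center (Sp ℓ))
    {v : Fin ℓ → ℝ} (hv : IsCocharacter π v) :
    ∃ ε : ℂˣ, (ε = 1 ∨ ε = -1) ∧ ∀ j, expUnit (v j) = ε := by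
  obtain ⟨ε, hε, h⟩ := exists_eq_torusElt_of_mem_center hℓ (hker (isCocharacter_iff.1 hv))
  exact ⟨ε, hε, congrFun (torusElt_injective h)⟩

/-- After lifting the conjugating element, the two sides differ by a central sign, which the
spectrum of `n` does not see. -/
theorem eigenvalues_eq_of_isConj_map (hℓ : 0 < ℓ) (hπ : Function.Surjective π)
    (hker : π.ker ≤ Subgroup.center (Sp ℓ)) {p : ℓ.Partition} {n : ↥(normTorus ℓ)}
    (hn : ConjClasses.mk (toWeyl n) = ellipticClass p) {η : ℂˣ}
    (hη : IsPrimitiveRoot η (bigM p)) {a : Fin ℓ → ℂˣ} (h : IsConj (π n) (π (torusElt a))) :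
    eigenvalues a = eigenvalues fun k => η ^ sigmaFun p k := by
  obtain ⟨c, hc⟩ := isConj_iff.1 h
  obtain ⟨g, rfl⟩ := hπ c
  have hz : g * n * g⁻¹ * (torusElt a)⁻¹ ∈ π.ker := by
    rw [MonoidHom.mem_ker, map_mul, map_mul, map_mul, map_inv, map_inv, hc, mul_inv_cancel]
  obtain ⟨ε, hε, hz⟩ := exists_eq_torusElt_of_mem_center hℓ (hker hz)
  rw [mul_inv_eq_iff_eq_mul, ← torusElt_mul] at hz
  have := eigenvalues_eq_of_isConj ((isConj_torusElt_pow_sigmaFun hn hη).symm.trans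
    (isConj_iff.2 ⟨g, hz⟩))
  rcases hε with rfl | rfl
  · rw [this]
    congr 1
    ext k
    simp
  · rw [← eigenvalues_neg hη, eigenvalues_neg_mul, this, ← eigenvalues_neg_mul]
    congr 1
    ext k
    simp

/-- With `M` the order of `π n`, the power `n ^ M` is central, hence `±1`, so `m ∣ 2M`; evenness of
`M` follows from `4 ∣ m`. -/
theorem exists_bigM_eq_orderOf_mul (hℓ : 0 < ℓ) (hker : π.ker ≤ Subgroup.center (Sp ℓ))
    {p : ℓ.Partition} {n : ↥(normTorus ℓ)}
    (hn : ConjClasses.mk (toWeyl n) = ellipticClass p) :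
    ∃ t, bigM p = orderOf (π n) * t ∧ t ∣ 2 ∧ 2 ∣ orderOf (π n) := by
  have hord := orderOf_eq_bigM hℓ hn
  obtain ⟨t, ht⟩ : orderOf (π n) ∣ bigM p := by
    rw [← hord]
    exact orderOf_map_dvd π n
  have h2 : bigM p ∣ orderOf (π n) * 2 := by
    rw [← hord]
    refine orderOf_dvd_of_pow_eq_one ?_
    have hk : (n : Sp ℓ) ^ orderOf (π n) ∈ π.ker := by
      rw [MonoidHom.mem_ker, map_pow, pow_orderOf_eq_one]
    obtain ⟨ε, hε, hz⟩ := exists_eq_torusElt_of_mem_center hℓ (hker hk)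
    rw [pow_mul, hz, ← torusElt_pow, ← torusElt_one]
    congr 1
    ext k
    rcases hε with rfl | rfl <;> simp
  have hpos := bigM_pos p
  have hM : 0 < orderOf (π n) := Nat.pos_of_mul_pos_right (ht ▸ hpos)
  rw [ht] at h2
  have ht2 := Nat.dvd_of_mul_dvd_mul_left hM h2
  refine ⟨t, ht, ht2, ?_⟩
  have h4 : bigM p = 4 * p.parts.lcm := rfl
  have : t ≤ 2 := Nat.le_of_dvd two_pos ht2
  interval_cases t <;> omega

end

/-! ### Existence and uniqueness of the Kac diagram -/

section

variable {ℓ : ℕ} {G : Type*} [Group G] {π : Sp ℓ →* G}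

theorem isPrimitiveRoot_expUnit_div {k : ℤ} {m M t : ℕ} (hk : IsCoprime k (M : ℤ)) (hm : 0 < m)
    (hmt : m = M * t) (ht : t ∣ 2) (hM : 2 ∣ M) : IsPrimitiveRoot (expUnit (k / m)) m := by
  refine isPrimitiveRoot_expUnit hm ?_
  rw [hmt, Nat.cast_mul]
  -- As `t ∣ 2 ∣ M`, the integer `k` is coprime to `t` too.
  exact hk.mul_right (hk.of_isCoprime_of_dvd_right (Int.natCast_dvd_natCast.2 (ht.trans hM)))

/-- The coordinates `σ_j / t` agree modulo `1`, so `t` divides the differences of the `σ_j`; the two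
end labels are even. -/
theorem dvd_labels_of_isCocharacter (hℓ : 0 < ℓ) (hker : π.ker ≤ Subgroup.center (Sp ℓ))
    {p : ℓ.Partition} {t : ℕ} (ht : t ∣ 2)
    (hv : IsCocharacter π fun j => (sigmaFun p j : ℝ) / t) (i : Fin (ℓ + 1)) :
    (t : ℤ) ∣ labels p i := by
  have ht0 : (t : ℝ) ≠ 0 := by
    rintro h
    rw [Nat.cast_eq_zero.1 h] at ht
    norm_num at ht
  have ht2 : (t : ℤ) ∣ 2 := by exact_mod_cast ht
  obtain ⟨ε, -, hε⟩ := hv.exists_eq hℓ hker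
  refine Fin.cases ?_ (fun k => ?_) i
  · rw [labels_zero hℓ]
    have h4 : bigM p = 4 * p.parts.lcm := rfl
    rw [h4]
    obtain ⟨c, hc⟩ := ht2
    exact ⟨c * (2 * p.parts.lcm - sigmaFun p ⟨0, hℓ⟩), by push_cast; rw [← mul_assoc, ← hc]; ring⟩
  · have hl := labels_succ p k
    rw [simpleRoot] at hl
    split_ifs at hl with h
    · obtain ⟨c, hc⟩ := expUnit_eq_iff.1 ((hε k).trans (hε ⟨k + 1, h⟩).symm)
      refine ⟨c, ?_⟩
      have : (labels p k.succ : ℝ) = t * c := by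
        rw [hl, ← hc]
        field_simp
      exact_mod_cast this
    · have : labels p k.succ = 2 * sigmaFun p k := by exact_mod_cast hl
      rw [this]
      exact ht2.mul_right _

theorem isKacDiagram_labels (hℓ : 0 < ℓ)
    (hker : π.ker ≤ Subgroup.center (Sp ℓ)) {p : ℓ.Partition} {n : ↥(normTorus ℓ)}
    (hn : ConjClasses.mk (toWeyl n) = ellipticClass p) {ξ : ℂˣ}
    (hξ : IsPrimitiveRoot ξ (orderOf (π n))) :
    IsKacDiagram π ξ (π n) (removeCommonFactors (labels p)) := by
  obtain ⟨t, hmt, ht, hM2⟩ := exists_bigM_eq_orderOf_mul hℓ hker hn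
  have hm := bigM_pos p
  have hM : 0 < orderOf (π n) := Nat.pos_of_mul_pos_right (hmt ▸ hm)
  have ht0 : 0 < t := Nat.pos_of_mul_pos_left (hmt ▸ hm)
  obtain ⟨k, hk, hpow⟩ := exists_cpow_eq_expUnit hM hξ
  have hmR : (bigM p : ℝ) = orderOf (π n) * t := by exact_mod_cast hmt
  have hMR : (0 : ℝ) < orderOf (π n) := by exact_mod_cast hM
  have htR : (0 : ℝ) < t := by exact_mod_cast ht0
  set v : Fin ℓ → ℝ := fun j => (sigmaFun p j : ℝ) / t with hv
  have hvσ : v = (t : ℝ)⁻¹ • fun j => (sigmaFun p j : ℝ) := by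
    ext j
    simp [hv, div_eq_inv_mul]
  have hchar : IsCocharacter π v := by
    -- The `M`-th power of the torus element with exponents `σ / m` has exponents `σ / t`, and its
    -- image is conjugate to `π n ^ M = 1`.
    have hconj := π.map_isConj (isConj_torusElt_pow_sigmaFun hn
      (isPrimitiveRoot_expUnit hm isCoprime_one_left))
    have h1 := pow_orderOf_eq_one (π (torusElt fun j => expUnit ((1 : ℤ) / bigM p) ^ sigmaFun p j))
    rw [← orderOf_eq_of_isConj hconj, ← map_pow, ← torusElt_pow] at h1
    rw [isCocharacter_iff, ← h1]
    congr 2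
    ext1 j
    rw [Pi.pow_apply, expUnit_pow, expUnit_pow, hmR, hv]
    congr 1
    push_cast
    field_simp
  choose s hs using fun i => dvd_labels_of_isCocharacter hℓ hker ht hchar i
  have hroot (j : Fin ℓ) : simpleRoot j v = s j.succ := by
    have : (labels p j.succ : ℝ) = t * s j.succ := by exact_mod_cast hs j.succ
    rw [hvσ, simpleRoot_smul, ← labels_succ, this, inv_mul_cancel_left₀ htR.ne']
  have hs0 (i) : 0 ≤ s i := by
    have := labels_nonneg hℓ p i
    rw [hs i] at this
    exact nonneg_of_mul_nonneg_right this (by exact_mod_cast ht0)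
  refine ⟨orderOf_pos_iff.1 hM, hξ, v, s, hchar, ?_, ⟨fun j => ?_, ?_⟩, hs0, ?_, ?_, ?_⟩
  -- The root `η = e^{2πik/m}` is matched to `ξ = e^{2πik/M}`: `(k/M)(σ/t) = (k/m)σ`.
  · have hconj := π.map_isConj (isConj_torusElt_pow_sigmaFun hn
      (isPrimitiveRoot_expUnit_div hk hm hmt ht hM2))
    convert hconj using 1
    rw [cocharValue]
    congr 2
    ext j
    rw [Units.val_mk0, hpow, expUnit_pow, hmR]
    congr 2
    simp only [hv]
    field_simp
  · rw [simpleRoot_smul, hroot]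
    have : (0 : ℝ) ≤ s j.succ := by exact_mod_cast hs0 _
    positivity
  · rw [highestRoot_eq]
    have : (2 * sigmaFun p ⟨0, hℓ⟩ : ℝ) ≤ bigM p := by
      exact_mod_cast (two_mul_sigmaFun_lt p ⟨0, hℓ⟩).le
    simp only [coordNat, hℓ, dif_pos, Pi.smul_apply, smul_eq_mul, hv]
    rw [hmR] at this
    field_simp
    exact this
  · congr 1
    exact ext_simpleRoot fun j => by rw [simpleRoot_sum_coweight, hroot]
  · have h1 := coordNat_zero_eq s hroot
    have h2 : (labels p 0 : ℝ) = t * s 0 := by exact_mod_cast hs 0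
    rw [labels_zero hℓ] at h2
    push_cast at h2
    have h3 : coordNat v 0 = sigmaFun p ⟨0, hℓ⟩ / t := by simp [coordNat, hℓ, hv]
    have : ((orderOf (π n) : ℤ) : ℝ) = ((∑ i, nodeCoeff i * s i : ℤ) : ℝ) := by
      rw [h1, h3, Int.cast_natCast]
      field_simp
      linarith
    exact_mod_cast this
  · rw [funext hs]
    exact removeCommonFactors_mul (by exact_mod_cast ht0) s

theorem IsKacDiagram.eq_labels (hℓ : 0 < ℓ) (hπ : Function.Surjective π)
    (hker : π.ker ≤ Subgroup.center (Sp ℓ)) {p : ℓ.Partition} {n : ↥(normTorus ℓ)}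
    (hn : ConjClasses.mk (toWeyl n) = ellipticClass p) {ξ : ℂˣ} {d : Fin (ℓ + 1) → ℤ}
    (hd : IsKacDiagram π ξ (π n) d) : d = removeCommonFactors (labels p) := by
  obtain ⟨hfin, hξ, v, s, hchar, hconj, halc, -, hvs, hMs, rfl⟩ := hd
  obtain ⟨t, hmt, ht, hM2⟩ := exists_bigM_eq_orderOf_mul hℓ hker hn
  have hm := bigM_pos p
  have hM : 0 < orderOf (π n) := Nat.pos_of_mul_pos_right (hmt ▸ hm)
  have ht0 : 0 < t := Nat.pos_of_mul_pos_left (hmt ▸ hm)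
  obtain ⟨k, hk, hpow⟩ := exists_cpow_eq_expUnit hM hξ
  have hmR : (bigM p : ℝ) = orderOf (π n) * t := by exact_mod_cast hmt
  have hMR : (0 : ℝ) < orderOf (π n) := by exact_mod_cast hM
  have htR : (0 : ℝ) < t := by exact_mod_cast ht0
  have hη := isPrimitiveRoot_expUnit_div hk hm hmt ht hM2
  have hvs' : v = ∑ k : Fin ℓ, (s k.succ : ℝ) • coweight k :=
    smul_right_injective _ (inv_ne_zero hMR.ne') hvs
  have hroot (j : Fin ℓ) : simpleRoot j v = s j.succ := by rw [hvs', simpleRoot_sum_coweight]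
  have hval : cocharValue π v ξ = π (torusElt fun j => expUnit (k / orderOf (π n) * v j)) := by
    rw [cocharValue]
    congr 2
    ext j
    rw [Units.val_mk0, hpow]
  rw [hval] at hconj
  have heig := eigenvalues_eq_of_isConj_map hℓ hπ hker hn hη hconj
  -- The spectrum makes `k t v_j` an integer and the cocharacter condition makes `2 v_j` one. Since
  -- `k` is odd, a Bézout relation for `k` and `2` makes `t v_j` an integer.
  have hint (j : Fin ℓ) : ∃ y : ℤ, t * v j = y := by
    have h1 : expUnit (k / orderOf (π n) * v j) ^ bigM p = 1 := by
      have hmem : expUnit (k / orderOf (π n) * v j) ∈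
          eigenvalues fun j => expUnit (k / orderOf (π n) * v j) :=
        Multiset.mem_add.2 (.inl (Multiset.mem_map_of_mem _ (Finset.mem_univ_val j)))
      rw [heig, eigenvalues, Multiset.mem_add, Multiset.mem_map, Multiset.mem_map] at hmem
      rcases hmem with ⟨i, -, hi⟩ | ⟨i, -, hi⟩ <;> rw [← hi]
      · rw [← pow_mul, mul_comm, pow_mul, hη.pow_eq_one, one_pow]
      · rw [Pi.inv_apply, inv_pow, ← pow_mul, mul_comm, pow_mul, hη.pow_eq_one, one_pow, inv_one]
    rw [expUnit_pow, expUnit_eq_one_iff] at h1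
    obtain ⟨x, hx⟩ := h1
    rw [hmR] at hx
    field_simp at hx
    obtain ⟨ε, hε, h2⟩ := hchar.exists_eq hℓ hker
    have h2 : expUnit (v j) ^ 2 = 1 := by
      rw [h2]
      rcases hε with rfl | rfl <;> simp
    rw [expUnit_pow, expUnit_eq_one_iff] at h2
    obtain ⟨z, hz⟩ := h2
    obtain ⟨a, b, hab⟩ := hk.of_isCoprime_of_dvd_right (Int.natCast_dvd_natCast.2 hM2)
    have habR : (a : ℝ) * k + b * 2 = 1 := by exact_mod_cast hab
    refine ⟨a * x + b * t * z, ?_⟩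
    push_cast at hz ⊢
    linear_combination (-(t * v j)) * habR + a * hx + b * t * hz
  obtain ⟨hanti, hbound⟩ := antitone_of_mem_closedAlcove halc
  have hvanti : Antitone v := fun i j hij => by
    have := hanti hij
    simp only [Pi.smul_apply, smul_eq_mul] at this
    exact le_of_mul_le_mul_left this (inv_pos.2 hMR)
  have hbound' (j : Fin ℓ) : 0 ≤ v j ∧ 2 * v j ≤ orderOf (π n) := by
    have := hbound j
    simp only [Pi.smul_apply, smul_eq_mul] at this
    refine ⟨nonneg_of_mul_nonneg_right this.1 (inv_pos.2 hMR), ?_⟩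
    have := this.2
    field_simp at this
    exact this
  have hnat (j : Fin ℓ) : ∃ u : ℕ, t * v j = u := by
    obtain ⟨y, hy⟩ := hint j
    have : 0 ≤ y := by
      have := mul_nonneg htR.le (hbound' j).1
      rw [hy] at this
      exact_mod_cast this
    lift y to ℕ using this
    exact ⟨y, by exact_mod_cast hy⟩
  choose u hu using hnat
  have hu2 (j : Fin ℓ) : 2 * u j ≤ bigM p := by
    have : (2 * u j : ℝ) ≤ bigM p := by
      rw [← hu, hmR]
      nlinarith [(hbound' j).2]
    exact_mod_cast this
  have huanti : Antitone u := fun i j hij => by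
    have : (u j : ℝ) ≤ u i := by
      rw [← hu, ← hu]
      exact mul_le_mul_of_nonneg_left (hvanti hij) htR.le
    exact_mod_cast this
  have huη : (fun j => expUnit (k / orderOf (π n) * v j)) =
      fun j => expUnit (k / bigM p) ^ u j := by
    ext1 j
    rw [expUnit_pow, ← hu, hmR]
    congr 1
    field_simp
  rw [huη] at heig
  -- The alcove supplies both the order and the bound `m/2`, so the spectrum leaves no choice for
  -- `u`.
  have huσ : u = sigmaFun p := eq_of_map_univ_eq huanti (antitone_sigmaFun p)
    (map_univ_eq_of_eigenvalues_eq hη hm hu2 (fun j => (two_mul_sigmaFun_lt p j).le) heig)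
  subst huσ
  have hlabels : labels p = fun i => (t : ℤ) * s i := by
    ext i
    refine Fin.cases ?_ (fun j => ?_) i
    · have h1 := coordNat_zero_eq s hroot
      rw [← hMs, coordNat, dif_pos hℓ, Int.cast_natCast] at h1
      have : (labels p 0 : ℝ) = t * s 0 := by
        rw [labels_zero hℓ]
        push_cast
        rw [← hu, hmR, h1]
        ring
      exact_mod_cast this
    · have : (labels p j.succ : ℝ) = t * s j.succ := by
        rw [labels_succ, ← hroot, ← simpleRoot_smul]
        congr 1
        ext j
        rw [← hu, Pi.smul_apply, smul_eq_mul]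
      exact_mod_cast this
  rw [hlabels, removeCommonFactors_mul (by exact_mod_cast ht0)]

end

end KacC

end

theorem mainTheorem6 (ℓ : ℕ) (hℓ : 2 ≤ ℓ) (p : ℓ.Partition)
    {G : Type*} [Group G] (π : KacC.Sp ℓ →* G) (hπ : Function.Surjective π)
    (hker : π.ker ≤ Subgroup.center (KacC.Sp ℓ))
    (n : ↥(KacC.normTorus ℓ)) (hn : ConjClasses.mk (KacC.toWeyl n) = KacC.ellipticClass p) :
    orderOf (n : KacC.Sp ℓ) = KacC.bigM p ∧
    IsOfFinOrder (π n) ∧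
    ∀ ξ : ℂˣ, IsPrimitiveRoot ξ (orderOf (π n)) → ∀ d : Fin (ℓ + 1) → ℤ,
      KacC.IsKacDiagram π ξ (π n) d ↔ d = KacC.removeCommonFactors (KacC.labels p) := by
  have hℓ0 : 0 < ℓ := by omega
  have hord := KacC.orderOf_eq_bigM hℓ0 hn
  refine ⟨hord, ?_, fun ξ hξ d => ⟨fun hd => hd.eq_labels hℓ0 hπ hker hn, ?_⟩⟩
  · exact π.isOfFinOrder (orderOf_pos_iff.1 (hord ▸ KacC.bigM_pos p))
  · rintro rfl
    exact KacC.isKacDiagram_labels hℓ0 hker hn hξ
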